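/- Let $A,B,B_0>0$ and $\alpha>\beta>1$. For $N$ particles $(x_k,m_k)\in\mathbb R^3\times\mathbb S^2$, $0\le k\le N-1$, with pairwise distinct positions, let $r_{k\ell}=x_k-x_\ell$ and $$U=\sum_{k}\sum_{\ell<k}\Big(B_0\frac{m_k\cdot m_\ell}{|r_{k\ell}|^{\beta}}-(B+B_0)\frac{(m_k\cdot r_{k\ell})(m_\ell\cdot r_{k\ell})}{|r_{k\ell}|^{\beta+2}}\Big)+\sum_{k}\sum_{\ell<k}\frac{A}{|r_{k\ell}|^{\alpha}},$$ with $U=+\infty$ if two positions coincide. For $P=(p_0,\dots,p_{N-1})\in\mathbb R^N$ let $S_P\in(\mathbb R^3\times\mathbb S^2)^N$ be the configuration $x_k=(p_k,0,0)$, $m_k=(1,0,0)$. A critical spear is a configuration $S_P$ with $p_0\le\dots\le p_{N-1}$ which is a critical point of $U$ on $(\mathbb R^3\times\mathbb S^2)^N$ (in particular, its positions are pairwise distinct). With $\zeta(s)=\sum_{k\ge1}k^{-s}$ put $$\check h=\Big(\frac{\alpha A}{\beta B\zeta(\beta)}\Big)^{\frac1{\alpha-\beta}},\qquad \bar h=\Big(\frac{\alpha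 A\zeta(\alpha)}{\beta B\zeta(\beta)}\Big)^{\frac1{\alpha-\beta}},\qquad \hat h=\Big(\frac{\alpha A}{\beta B}\Big)^{\frac1{\alpha-\beta}}.$$ (i) For every $N$ there is $P_0\in\mathbb R^N$ such that $S_{P_0}$ is a critical spear and $U(S_{P_0})=\min_{P\in\mathbb R^N}U(S_P)$. (ii) Every critical spear satisfies $\check h\le|x_{k-1}-x_k|\le\hat h$ for all $k=1,\dots,N-1$. (iii) For every $\beta\ge3$ there is $\alpha_*=\alpha_*(\beta)$, depending only on $\beta$, such that the following holds whenever $\alpha>\beta$, $\alpha>\alpha_*$ and $A,B,B_0>0$. For every $N$ the critical spear is unique up to translation along the axis: if $S_P$ and $S_Q$ are critical spears of $N$ particles, then $Q=P+(t,\dots,t)$ for some $t\in\mathbb R$. Moreover, there are constants $c,C>0$ independent of $N$ such that, for every $N$, every critical spear of $N$ particles satisfies, for all $k=1,\dots,N-1$, $$\bar h+\frac{c}{N^{\beta-1}}\le|x_{k-1}-x_k|\le\bar h+C\Big(\frac1{N^{\beta-1}}+\frac1{k^{\beta-1}}+\frac1{(N-k)^{\beta-1}}\Big).$$ -/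

import Mathlib

noncomputable section

namespace MagneticChain

/-- Euclidean three-space. -/
abbrev E3 : Type := EuclideanSpace ℝ (Fin 3)

/-- The unit sphere of `ℝ³`, in which the spins live. -/
abbrev S2 : Type := Metric.sphere (0 : E3) 1

/-- Configurations `((x_0, m_0), …, (x_{N-1}, m_{N-1}))` in `(ℝ³ × 𝕊²)^N`. -/
abbrev Config (N : ℕ) : Type := Fin N → E3 × S2

/-- Dipolar interaction of `(x, m)` and `(x', m')`, with `r = x - x'`:
`B₀ (m ⬝ m') / |r|^β - (B + B₀) (m ⬝ r) (m' ⬝ r) / |r|^(β + 2)`. -/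
def dipolarPair (B B₀ β : ℝ) (a b : E3 × S2) : ℝ :=
  B₀ * (inner ℝ (a.2 : E3) (b.2 : E3) / ‖a.1 - b.1‖ ^ β) -
    (B + B₀) * (inner ℝ (a.2 : E3) (a.1 - b.1) * inner ℝ (b.2 : E3) (a.1 - b.1) /
      ‖a.1 - b.1‖ ^ (β + 2))

/-- Soft-sphere repulsion `A / |r|^α`. -/
def repulsivePair (A α : ℝ) (a b : E3 × S2) : ℝ :=
  A * (1 / ‖a.1 - b.1‖ ^ α)

/-- The magnetic-repulsive energy `U = U^d + U^s`: each pair is counted once. -/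
def energy (A B B₀ α β : ℝ) {N : ℕ} (S : Config N) : ℝ :=
  (∑ k : Fin N, ∑ l ∈ Finset.Iio k, dipolarPair B B₀ β (S k) (S l)) +
    ∑ k : Fin N, ∑ l ∈ Finset.Iio k, repulsivePair A α (S k) (S l)

/-- The positions are pairwise distinct. This is the domain of the energy: at a collision the
energy is `+∞` (the repulsion dominates), whereas the real-valued formula takes a junk value. -/
def CollisionFree {N : ℕ} (S : Config N) : Prop :=
  Function.Injective fun k => (S k).1

/-- `S` is a critical point of the energy on the manifold `(ℝ³ × 𝕊²)^N`: the energy is defined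
at `S`, and its derivative at `S` vanishes along every curve in `(ℝ³ × 𝕊²)^N` that passes
through `S` at time `0` and is differentiable there. -/
def IsCriticalPoint (A B B₀ α β : ℝ) {N : ℕ} (S : Config N) : Prop :=
  CollisionFree S ∧
    ∀ γ : ℝ → Config N, γ 0 = S →
      (∀ k, DifferentiableAt ℝ (fun t => (γ t k).1) 0) →
      (∀ k, DifferentiableAt ℝ (fun t => ((γ t k).2 : E3)) 0) →
      HasDerivAt (fun t => energy A B B₀ α β (γ t)) 0 0

/-- The spin `(1, 0, 0)`. -/
def axisSpin : S2 :=
  ⟨EuclideanSpace.single 0 1, by simp⟩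

/-- The aligned configuration `x_k = (p_k, 0, 0)`, `m_k = (1, 0, 0)`. -/
def spear {N : ℕ} (P : Fin N → ℝ) : Config N :=
  fun k => (EuclideanSpace.single 0 (P k), axisSpin)

/-- `P` is ordered, `p_0 ≤ … ≤ p_{N-1}`, and its spear is a critical point of the energy on
`(ℝ³ × 𝕊²)^N`. -/
def IsCriticalSpear (A B B₀ α β : ℝ) {N : ℕ} (P : Fin N → ℝ) : Prop :=
  Monotone P ∧ IsCriticalPoint A B B₀ α β (spear P)

/-- `P` minimizes the energy of the spear among all position vectors in `ℝ^N`, in any order, at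
which the energy is finite, that is, with pairwise distinct entries. -/
def IsMinimizingSpear (A B B₀ α β : ℝ) {N : ℕ} (P : Fin N → ℝ) : Prop :=
  CollisionFree (spear P) ∧
    ∀ Q : Fin N → ℝ, CollisionFree (spear Q) →
      energy A B B₀ α β (spear P) ≤ energy A B B₀ α β (spear Q)

/-- The distance `|x_{k-1} - x_k|` in `ℝ³` between neighbours of the spear, `1 ≤ k ≤ N - 1`. -/
def gap {N : ℕ} (P : Fin N → ℝ) (k : ℕ) (hk : k < N) : ℝ :=
  ‖(spear P ⟨k - 1, lt_of_le_of_lt (Nat.sub_le k 1) hk⟩).1 - (spear P ⟨k, hk⟩).1‖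

/-- `ζ(s) = ∑_{k ≥ 1} 1 / k^s`, for real `s > 1`. -/
def zeta (s : ℝ) : ℝ :=
  ∑' n : ℕ, 1 / ((n : ℝ) + 1) ^ s

/-- The lower distance `(α A / (β B ζ(β)))^(1/(α-β))`. -/
def hCheck (A B α β : ℝ) : ℝ :=
  (α * A / (β * B * zeta β)) ^ (1 / (α - β))

/-- The limit distance `(α A ζ(α) / (β B ζ(β)))^(1/(α-β))`. -/
def hBar (A B α β : ℝ) : ℝ :=
  (α * A * zeta α / (β * B * zeta β)) ^ (1 / (α - β))

/-- The upper distance `(α A / (β B))^(1/(α-β))`. -/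
def hHat (A B α β : ℝ) : ℝ :=
  (α * A / (β * B)) ^ (1 / (α - β))

end MagneticChain

end

open MagneticChain

/-!
The spins stay on the sphere, so varying them at the axis costs no energy to first order: a spear is
critical exactly when the axial forces balance, that is, when for every bond the forces of all
pairs across it add up to zero. Lengths are measured in units of `hHat`, where the pair force
vanishes.

No bond exceeds `1`, since all pairs across it would attract each other, and shortening long bonds
to `1` does not increase the energy; as the repulsion blows up at short distance, compactness gives
a minimizer. The repulsion in the shortest bond is balanced by an attraction of at most `ζ(β)`,
which bounds it from below.

For large `α` neighbours interact so stiffly that the difference of two nearly balanced chains obeys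
a maximum principle. This yields uniqueness and, by comparison with the infinite equidistant chain,
whose bond length is `hBar`, the upper bound of (iii). Compared with that infinite chain, a
finite one lacks the attraction of the particles beyond its ends, which keeps its shortest bond
above `hBar` by a multiple of `N ^ (1 - β)`.
-/

namespace MagneticChain

/-! ### Sums of powers -/

lemma hasSum_zeta {s : ℝ} (hs : 1 < s) : HasSum (fun n : ℕ => (n : ℝ) ^ (-s)) (zeta s) := by
  have hsum : Summable fun n : ℕ => (n : ℝ) ^ (-s) := Real.summable_nat_rpow.2 (by linarith)
  convert hsum.hasSum using 1
  rw [hsum.tsum_eq_zero_add, Nat.cast_zero, Real.zero_rpow (by linarith), zero_add]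
  refine tsum_congr fun n => ?_
  rw [Real.rpow_neg (by positivity), one_div, Nat.cast_add_one]

lemma sum_range_rpow_neg_le_zeta {s : ℝ} (hs : 1 < s) (M : ℕ) :
    ∑ n ∈ Finset.range M, (n : ℝ) ^ (-s) ≤ zeta s :=
  sum_le_hasSum _ (fun _ _ => by positivity) (hasSum_zeta hs)

lemma one_le_zeta {s : ℝ} (hs : 1 < s) : 1 ≤ zeta s := by
  simpa [Finset.sum_range_succ, Real.zero_rpow (show -s ≠ 0 by linarith)]
    using sum_range_rpow_neg_le_zeta hs 2

lemma zeta_pos {s : ℝ} (hs : 1 < s) : 0 < zeta s :=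
  zero_lt_one.trans_le (one_le_zeta hs)

lemma antitoneOn_zeta : AntitoneOn zeta (Set.Ioi 1) := by
  rintro s (hs : 1 < s) t (ht : 1 < t) hst
  refine hasSum_le (fun n => ?_) (hasSum_zeta ht) (hasSum_zeta hs)
  obtain rfl | hn := n.eq_zero_or_pos
  · simp [(zero_lt_one.trans hs).ne', (zero_lt_one.trans ht).ne']
  · exact Real.rpow_le_rpow_of_exponent_le (by exact_mod_cast hn) (neg_le_neg hst)

lemma sum_Ico_rpow_neg_le {s : ℝ} (hs : 1 < s) {a : ℕ} (ha : 1 ≤ a) (M : ℕ) :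
    ∑ n ∈ Finset.Ico a M, (n : ℝ) ^ (-s) ≤ s / (s - 1) * (a : ℝ) ^ (1 - s) := by
  have ha' : (1 : ℝ) ≤ a := by exact_mod_cast ha
  have hs' : 0 < s - 1 := by linarith
  rcases le_or_gt M a with h | h
  · rw [Finset.Ico_eq_empty_of_le h, Finset.sum_empty]
    positivity
  obtain ⟨b, rfl⟩ := Nat.exists_eq_add_of_lt h
  have hpos : ∀ x ∈ Set.Icc (a : ℝ) (a + b : ℕ), 0 < x := fun x hx => by linarith [hx.1]
  have htail : ∑ n ∈ Finset.Ico a (a + b), ((n + 1 : ℕ) : ℝ) ^ (-s) ≤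
      (a : ℝ) ^ (1 - s) / (s - 1) := by
    refine (AntitoneOn.sum_le_integral_Ico (f := fun x : ℝ => x ^ (-s)) (by omega)
      fun x hx _ _ hxy => Real.rpow_le_rpow_of_nonpos (hpos x hx) hxy (by linarith)).trans ?_
    rw [integral_rpow (Or.inr ⟨by linarith, fun h0 => (hpos 0 (by
      rwa [Set.uIcc_of_le (by exact_mod_cast a.le_add_right b)] at h0)).false⟩),
      show -s + 1 = -(s - 1) by ring, show 1 - s = -(s - 1) by ring, div_neg, ← neg_div, neg_sub]
    gcongr
    linarith [show (0 : ℝ) ≤ ((a + b : ℕ) : ℝ) ^ (-(s - 1)) by positivity]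
  have hhead : (a : ℝ) ^ (-s) ≤ (a : ℝ) ^ (1 - s) :=
    Real.rpow_le_rpow_of_exponent_le ha' (by linarith)
  have hsplit : s / (s - 1) * (a : ℝ) ^ (1 - s) =
      (a : ℝ) ^ (1 - s) + (a : ℝ) ^ (1 - s) / (s - 1) := by
    field_simp
    ring
  rw [Finset.sum_eq_sum_Ico_succ_bot h, ← Finset.sum_Ico_add' (fun n : ℕ => (n : ℝ) ^ (-s)), hsplit]
  exact add_le_add hhead htail

lemma le_sum_Ico_rpow_neg {s : ℝ} (hs : 0 ≤ s) {a : ℕ} (ha : 1 ≤ a) :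
    (2 : ℝ) ^ (-s) * (a : ℝ) ^ (1 - s) ≤ ∑ n ∈ Finset.Ico a (2 * a), (n : ℝ) ^ (-s) := by
  have ha' : (0 : ℝ) < a := by exact_mod_cast ha
  have hterm : ∀ n ∈ Finset.Ico a (2 * a), ((2 * a : ℕ) : ℝ) ^ (-s) ≤ (n : ℝ) ^ (-s) := by
    intro n hn
    rw [Finset.mem_Ico] at hn
    exact Real.rpow_le_rpow_of_nonpos (by exact_mod_cast (by omega : 0 < n))
      (by exact_mod_cast hn.2.le) (by linarith)
  refine le_trans (le_of_eq ?_) (Finset.card_nsmul_le_sum _ _ _ hterm)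
  rw [Nat.card_Ico, nsmul_eq_mul, show 2 * a - a = a by omega, Nat.cast_mul, Nat.cast_ofNat,
    Real.mul_rpow (by norm_num) ha'.le, sub_eq_add_neg, Real.rpow_add ha', Real.rpow_one]
  ring

lemma mul_rpow_neg_add_one {x s : ℝ} (hx : 0 ≤ x) (hs : s ≠ 0) : x * x ^ (-(s + 1)) = x ^ (-s) := by
  rw [mul_comm, ← Real.rpow_add_one' hx (by simpa using hs)]
  ring_nf

lemma rpow_neg_le_two_rpow_mul {x y s : ℝ} (hs : 0 ≤ s) (hx : 0 < x) (hxy : x ≤ 2 * y) :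
    y ^ (-s) ≤ 2 ^ s * x ^ (-s) := by
  have h := Real.rpow_le_rpow_of_nonpos hx hxy (neg_nonpos.2 hs)
  rw [Real.mul_rpow (by norm_num) (by linarith)] at h
  calc y ^ (-s) = 2 ^ s * (2 ^ (-s) * y ^ (-s)) := by
        rw [← mul_assoc, ← Real.rpow_add two_pos, add_neg_cancel, Real.rpow_zero, one_mul]
    _ ≤ 2 ^ s * x ^ (-s) := by gcongr

/-! ### Pairs of particles across a bond -/

/-- The pairs `(i, j)` of particles of the chain `0, …, N - 1` that lie on different sides of the
bond between `p` and `p + 1`. -/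
def pairsAcross (p N : ℕ) : Finset (ℕ × ℕ) :=
  Finset.range (p + 1) ×ˢ Finset.Ico (p + 1) N

variable {p N : ℕ}

lemma mem_pairsAcross {q : ℕ × ℕ} : q ∈ pairsAcross p N ↔ q.1 ≤ p ∧ p < q.2 ∧ q.2 < N := by
  simp [pairsAcross]

lemma self_mem_pairsAcross (hp : p + 1 < N) : (p, p + 1) ∈ pairsAcross p N := by
  simp [mem_pairsAcross, hp]

lemma sub_pos_of_mem_pairsAcross {q : ℕ × ℕ} (hq : q ∈ pairsAcross p N) :
    0 < ((q.2 - q.1 : ℕ) : ℝ) := by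
  rw [mem_pairsAcross] at hq
  exact_mod_cast (by omega)

lemma two_le_sub_of_mem_pairsAcross {q : ℕ × ℕ} (hq : q ∈ pairsAcross p N)
    (hne : q ≠ (p, p + 1)) : 2 ≤ q.2 - q.1 := by
  rw [mem_pairsAcross] at hq
  rw [ne_eq, Prod.ext_iff] at hne
  omega

lemma card_filter_pairsAcross (n : ℕ) :
    ((pairsAcross p N).filter fun q => q.2 - q.1 = n).card =
      min n (p + 1) - (n - (N - 1 - p)) := by
  rw [← Nat.card_Ico]
  refine Finset.card_bij' (fun q _ => p - q.1) (fun a _ => (p - a, p - a + n)) ?_ ?_ ?_ ?_ <;>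
  · simp only [Finset.mem_filter, mem_pairsAcross, Finset.mem_Ico, Prod.forall, Prod.mk.injEq]
    omega

lemma sum_pairsAcross_dist (F : ℕ → ℝ) {M : ℕ} (hM : N ≤ M) :
    ∑ q ∈ pairsAcross p N, F (q.2 - q.1) =
      ∑ n ∈ Finset.range M, ((min n (p + 1) - (n - (N - 1 - p)) : ℕ) : ℝ) * F n := by
  have hmaps : ∀ q ∈ pairsAcross p N, q.2 - q.1 ∈ Finset.range M := fun q hq => by
    rw [mem_pairsAcross] at hq
    rw [Finset.mem_range]
    omega
  rw [← Finset.sum_fiberwise_of_maps_to hmaps]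
  refine Finset.sum_congr rfl fun n _ => ?_
  rw [← card_filter_pairsAcross, ← nsmul_eq_mul, ← Finset.sum_const]
  exact Finset.sum_congr rfl fun q hq => by rw [(Finset.mem_filter.1 hq).2]

lemma sum_pairsAcross_dist_le (hp : p + 1 < N) {F : ℕ → ℝ} (hF : ∀ n, 2 ≤ n → 0 ≤ F n) :
    ∑ q ∈ pairsAcross p N, F (q.2 - q.1) ≤ ∑ n ∈ Finset.range N, (n : ℝ) * F n := by
  rw [sum_pairsAcross_dist F le_rfl]
  refine Finset.sum_le_sum fun n _ => ?_
  rcases le_or_gt 2 n with h | h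
  · exact mul_le_mul_of_nonneg_right (by exact_mod_cast (by omega)) (hF n h)
  · rw [show min n (p + 1) - (n - (N - 1 - p)) = n by omega]

-- The pairs at distance `n` that are missing at a bond would reach beyond one of the two ends.
lemma sum_range_le_sum_pairsAcross_dist (hp : p + 1 < N) {F : ℕ → ℝ}
    (hF : ∀ n, 2 ≤ n → 0 ≤ F n) {M : ℕ} (hM : N ≤ M) :
    ∑ n ∈ Finset.range M, (n : ℝ) * F n ≤ ∑ q ∈ pairsAcross p N, F (q.2 - q.1) +
      (∑ n ∈ Finset.Ico (p + 2) M, (n : ℝ) * F n +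
        ∑ n ∈ Finset.Ico (N - p) M, (n : ℝ) * F n) := by
  have htail : ∀ a, ∑ n ∈ Finset.Ico a M, (n : ℝ) * F n =
      ∑ n ∈ Finset.range M, if a ≤ n then (n : ℝ) * F n else 0 := fun a => by
    rw [← Finset.sum_filter]
    refine Finset.sum_congr ?_ fun _ _ => rfl
    ext n
    simp only [Finset.mem_filter, Finset.mem_Ico, Finset.mem_range, and_comm]
  rw [sum_pairsAcross_dist F hM, htail, htail, ← Finset.sum_add_distrib, ← Finset.sum_add_distrib]
  refine Finset.sum_le_sum fun n _ => ?_
  by_cases hn : p + 2 ≤ n ∨ N - p ≤ n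
  · have hFn := hF n (by omega)
    have hterm : 0 ≤ (n : ℝ) * F n := by positivity
    have hcount : 0 ≤ ((min n (p + 1) - (n - (N - 1 - p)) : ℕ) : ℝ) * F n := by positivity
    split_ifs <;> first | linarith | omega
  · rw [if_neg (by omega), if_neg (by omega),
      show min n (p + 1) - (n - (N - 1 - p)) = n by omega]
    simp

lemma sum_pairsAcross_rpow_le {s : ℝ} (hs : 1 < s) (hp : p + 1 < N) :
    ∑ q ∈ pairsAcross p N, ((q.2 - q.1 : ℕ) : ℝ) ^ (-(s + 1)) ≤ zeta s := by
  refine (sum_pairsAcross_dist_le hp (F := fun n : ℕ => (n : ℝ) ^ (-(s + 1)))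
    fun n _ => by positivity).trans (le_trans (le_of_eq ?_) (sum_range_rpow_neg_le_zeta hs N))
  exact Finset.sum_congr rfl fun n _ => mul_rpow_neg_add_one n.cast_nonneg (by linarith)

/-! ### The influence of the two ends -/

/-- The order of magnitude of the influence of the two ends of a chain of `N` particles on the bond
between `l` and `l + 1`. -/
noncomputable def endEffect (β : ℝ) (N l : ℕ) : ℝ :=
  ((l + 1 : ℕ) : ℝ) ^ (1 - β) + ((N - 1 - l : ℕ) : ℝ) ^ (1 - β)

/-- Bounds the norm of the convolution with `n ^ (-(β + 1))` as an operator on chains weighted by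
`endEffect`; see `sum_pairsAcross_endEffect_le`. -/
noncomputable def convConst (β : ℝ) : ℝ :=
  2 ^ (β - 1) * (zeta β + β / (β - 1))

variable {β : ℝ}

lemma endEffect_pos {l : ℕ} : 0 < endEffect β N l := by
  unfold endEffect
  positivity

lemma sum_Ico_mul_le_mul_rpow (hβ : 1 < β) {F : ℕ → ℝ} {K : ℝ} (hK : 0 ≤ K)
    (hFK : ∀ n : ℕ, 2 ≤ n → (n : ℝ) * F n ≤ K * (n : ℝ) ^ (-β)) {a b : ℕ} (hb : 1 ≤ b)
    (hba : b ≤ a) (ha : 2 ≤ a) (M : ℕ) :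
    ∑ n ∈ Finset.Ico a M, (n : ℝ) * F n ≤ K * (β / (β - 1)) * (b : ℝ) ^ (1 - β) := by
  have := sub_pos.2 hβ
  calc ∑ n ∈ Finset.Ico a M, (n : ℝ) * F n ≤ ∑ n ∈ Finset.Ico a M, K * (n : ℝ) ^ (-β) :=
        Finset.sum_le_sum fun n hn => hFK n (ha.trans (Finset.mem_Ico.1 hn).1)
    _ ≤ K * (β / (β - 1) * (a : ℝ) ^ (1 - β)) := by
        rw [← Finset.mul_sum]
        gcongr
        exact sum_Ico_rpow_neg_le hβ (hb.trans hba) M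
    _ ≤ K * (β / (β - 1)) * (b : ℝ) ^ (1 - β) := by
        rw [mul_assoc]
        gcongr K * (β / (β - 1) * ?_)
        exact Real.rpow_le_rpow_of_nonpos (by exact_mod_cast hb) (by exact_mod_cast hba)
          (by linarith)

lemma abs_sum_pairsAcross_sub_le (hβ : 1 < β) (hp : p + 1 < N) {F : ℕ → ℝ} {S K : ℝ}
    (hS : HasSum (fun n : ℕ => (n : ℝ) * F n) S) (hF : ∀ n, 2 ≤ n → 0 ≤ F n)
    (hFK : ∀ n : ℕ, 2 ≤ n → (n : ℝ) * F n ≤ K * (n : ℝ) ^ (-β)) :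
    |∑ q ∈ pairsAcross p N, F (q.2 - q.1) - S| ≤ K * (β / (β - 1)) * endEffect β N p := by
  have hK : 0 ≤ K := by
    have h := (mul_nonneg (Nat.cast_nonneg 2) (hF 2 le_rfl)).trans (hFK 2 le_rfl)
    exact nonneg_of_mul_nonneg_left h (by positivity)
  have := sub_pos.2 hβ
  have hend := endEffect_pos (β := β) (N := N) (l := p)
  have hupper : ∑ q ∈ pairsAcross p N, F (q.2 - q.1) ≤ S :=
    (sum_pairsAcross_dist_le hp hF).trans <| sum_le_hasSum _ (fun n hn => by
      rw [Finset.mem_range, not_lt] at hn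
      exact mul_nonneg n.cast_nonneg (hF n (by omega))) hS
  have hlower : S ≤ ∑ q ∈ pairsAcross p N, F (q.2 - q.1) +
      K * (β / (β - 1)) * endEffect β N p := by
    refine le_of_tendsto hS.tendsto_sum_nat ?_
    filter_upwards [Filter.eventually_ge_atTop N] with M hM
    refine (sum_range_le_sum_pairsAcross_dist hp hF hM).trans ?_
    rw [endEffect, mul_add]
    gcongr
    · exact sum_Ico_mul_le_mul_rpow hβ hK hFK (by omega) (by omega) (by omega) M
    · exact sum_Ico_mul_le_mul_rpow hβ hK hFK (by omega) (by omega) (by omega) M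
  rw [abs_le]
  constructor
  · linarith
  · have : 0 ≤ K * (β / (β - 1)) * endEffect β N p := by positivity
    linarith

lemma sum_pairsAcross_far_le (hβ : 1 < β) (hp : p + 1 < N) {k : ℕ} (hk : 1 ≤ k) :
    ∑ q ∈ pairsAcross p N, ((q.2 - q.1 : ℕ) : ℝ) ^ (-(β + 1)) *
        (if k < 2 * (q.2 - q.1) then (1 : ℝ) else 0) ≤
      2 ^ (β - 1) * (β / (β - 1)) * (k : ℝ) ^ (1 - β) := by
  have hk0 : (0 : ℝ) < k := by exact_mod_cast hk
  have hβ' : 0 < β - 1 := by linarith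
  have hfar : Finset.Ico (k / 2 + 1) N = (Finset.range N).filter fun n => k < 2 * n := by
    ext n
    simp only [Finset.mem_filter, Finset.mem_Ico, Finset.mem_range]
    omega
  calc ∑ q ∈ pairsAcross p N, ((q.2 - q.1 : ℕ) : ℝ) ^ (-(β + 1)) *
        (if k < 2 * (q.2 - q.1) then (1 : ℝ) else 0)
      ≤ ∑ n ∈ Finset.range N, (n : ℝ) * ((n : ℝ) ^ (-(β + 1)) *
          (if k < 2 * n then (1 : ℝ) else 0)) :=
        sum_pairsAcross_dist_le hp
          (F := fun n : ℕ => (n : ℝ) ^ (-(β + 1)) * (if k < 2 * n then (1 : ℝ) else 0))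
          fun n _ => by positivity
    _ = ∑ n ∈ Finset.Ico (k / 2 + 1) N, (n : ℝ) ^ (-β) := by
        rw [hfar, Finset.sum_filter]
        refine Finset.sum_congr rfl fun n _ => ?_
        rw [← mul_assoc, mul_rpow_neg_add_one n.cast_nonneg (by linarith), mul_ite, mul_one,
          mul_zero]
    _ ≤ β / (β - 1) * ((k / 2 + 1 : ℕ) : ℝ) ^ (1 - β) := sum_Ico_rpow_neg_le hβ (by omega) N
    _ ≤ β / (β - 1) * (2 ^ (β - 1) * (k : ℝ) ^ (1 - β)) := by
        gcongr
        rw [← neg_sub β 1]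
        exact rpow_neg_le_two_rpow_mul hβ'.le hk0 (by exact_mod_cast (by omega))
    _ = 2 ^ (β - 1) * (β / (β - 1)) * (k : ℝ) ^ (1 - β) := by ring

-- For `2 * n ≤ k` the two weights are comparable; otherwise `1` is a good enough bound.
lemma rpow_one_sub_le_of_le_add (hβ : 1 ≤ β) {k l n : ℕ} (hk : 1 ≤ k) (hl : 1 ≤ l)
    (hkl : k ≤ l + n) :
    (l : ℝ) ^ (1 - β) ≤ 2 ^ (β - 1) * (k : ℝ) ^ (1 - β) + if k < 2 * n then 1 else 0 := by
  split_ifs with h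
  · exact (Real.rpow_le_one_of_one_le_of_nonpos (by exact_mod_cast hl) (by linarith)).trans
      (le_add_of_nonneg_left (by positivity))
  · rw [add_zero, ← neg_sub β 1]
    exact rpow_neg_le_two_rpow_mul (by linarith) (by exact_mod_cast hk)
      (by exact_mod_cast (by omega))

lemma sum_pairsAcross_dist_to_end_le (hβ : 1 < β) (hp : p + 1 < N) {δ : ℕ → ℕ}
    (hδ : ∀ l, l + 1 < N → 1 ≤ δ l) (hδp : ∀ l, δ p ≤ δ l + ((p - l) + (l - p))) :
    ∑ q ∈ pairsAcross p N, ((q.2 - q.1 : ℕ) : ℝ) ^ (-(β + 2)) *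
        ∑ l ∈ Finset.Ico q.1 q.2, (δ l : ℝ) ^ (1 - β) ≤ convConst β * (δ p : ℝ) ^ (1 - β) := by
  have hterm : ∀ q ∈ pairsAcross p N, ((q.2 - q.1 : ℕ) : ℝ) ^ (-(β + 2)) *
      ∑ l ∈ Finset.Ico q.1 q.2, (δ l : ℝ) ^ (1 - β) ≤
      2 ^ (β - 1) * (δ p : ℝ) ^ (1 - β) * ((q.2 - q.1 : ℕ) : ℝ) ^ (-(β + 1)) +
      ((q.2 - q.1 : ℕ) : ℝ) ^ (-(β + 1)) * (if δ p < 2 * (q.2 - q.1) then (1 : ℝ) else 0) := by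
    intro q hq
    have hn := sub_pos_of_mem_pairsAcross hq
    rw [mem_pairsAcross] at hq
    set b := 2 ^ (β - 1) * (δ p : ℝ) ^ (1 - β) + if δ p < 2 * (q.2 - q.1) then (1 : ℝ) else 0
    have hl : ∀ l ∈ Finset.Ico q.1 q.2, (δ l : ℝ) ^ (1 - β) ≤ b := fun l hl => by
      rw [Finset.mem_Ico] at hl
      exact rpow_one_sub_le_of_le_add hβ.le (hδ p hp) (hδ l (by omega)) ((hδp l).trans (by omega))
    have hsum := Finset.sum_le_card_nsmul _ _ _ hl
    rw [Nat.card_Ico, nsmul_eq_mul] at hsum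
    refine (mul_le_mul_of_nonneg_left hsum (by positivity)).trans (le_of_eq ?_)
    rw [mul_left_comm, ← mul_assoc, show β + 2 = β + 1 + 1 by ring,
      mul_rpow_neg_add_one hn.le (by linarith)]
    ring
  refine (Finset.sum_le_sum hterm).trans ?_
  rw [Finset.sum_add_distrib, ← Finset.mul_sum]
  calc _ ≤ 2 ^ (β - 1) * (δ p : ℝ) ^ (1 - β) * zeta β +
        2 ^ (β - 1) * (β / (β - 1)) * (δ p : ℝ) ^ (1 - β) :=
        add_le_add (mul_le_mul_of_nonneg_left (sum_pairsAcross_rpow_le hβ hp) (by positivity))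
          (sum_pairsAcross_far_le hβ hp (hδ p hp))
    _ = convConst β * (δ p : ℝ) ^ (1 - β) := by
        unfold convConst
        ring

lemma sum_pairsAcross_endEffect_le (hβ : 1 < β) (hp : p + 1 < N) :
    ∑ q ∈ pairsAcross p N, ((q.2 - q.1 : ℕ) : ℝ) ^ (-(β + 2)) *
        ∑ l ∈ Finset.Ico q.1 q.2, endEffect β N l ≤ convConst β * endEffect β N p := by
  simp only [endEffect, Finset.sum_add_distrib, mul_add]
  exact add_le_add
    (sum_pairsAcross_dist_to_end_le hβ hp (δ := fun l => l + 1) (fun l _ => by omega)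
      fun l => by omega)
    (sum_pairsAcross_dist_to_end_le hβ hp (δ := fun l => N - 1 - l) (fun l _ => by omega)
      fun l => by omega)

/-! ### The pair force -/

/-- The attraction between two particles at distance `r`, in units in which it vanishes at `1`. -/
noncomputable def pairForce (α β r : ℝ) : ℝ :=
  r ^ (-(β + 1)) - r ^ (-(α + 1))

variable {α r : ℝ}

lemma hasDerivAt_pairForce (α β : ℝ) (hr : r ≠ 0) :
    HasDerivAt (pairForce α β) ((α + 1) * r ^ (-(α + 2)) - (β + 1) * r ^ (-(β + 2))) r := by
  have hβ := Real.hasDerivAt_rpow_const (p := -(β + 1)) (Or.inl hr)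
  have hα := Real.hasDerivAt_rpow_const (p := -(α + 1)) (Or.inl hr)
  refine (hβ.sub hα).congr_deriv ?_
  rw [show -(β + 1) - 1 = -(β + 2) by ring, show -(α + 1) - 1 = -(α + 2) by ring]
  ring

lemma pairForce_eq_mul_one_sub (α β : ℝ) (hr : 0 < r) :
    pairForce α β r = r ^ (-(β + 1)) * (1 - r ^ (-(α - β))) := by
  rw [pairForce, mul_sub, mul_one, ← Real.rpow_add hr]
  ring_nf

lemma pairForce_pos (hαβ : β < α) (hr : 1 < r) : 0 < pairForce α β r :=
  sub_pos.2 (Real.rpow_lt_rpow_of_exponent_lt hr (by linarith))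

lemma pairForce_nonneg (hαβ : β ≤ α) (hr : 1 ≤ r) : 0 ≤ pairForce α β r :=
  sub_nonneg.2 (Real.rpow_le_rpow_of_exponent_le hr (by linarith))

lemma pairForce_nonpos (hαβ : β ≤ α) (hr : 0 < r) (hr1 : r ≤ 1) : pairForce α β r ≤ 0 :=
  sub_nonpos.2 (Real.rpow_le_rpow_of_exponent_ge hr hr1 (by linarith))

lemma pairForce_le (hr : 0 ≤ r) : pairForce α β r ≤ r ^ (-(β + 1)) :=
  sub_le_self _ (by positivity)

lemma mul_sub_le_pairForce_sub (hβ : 0 < β) (hαβ : β < α) {r' : ℝ} (hr : 0 < r) (hrr' : r ≤ r')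
    (hr' : r' ≤ 1) : (α - β) * (r' - r) ≤ pairForce α β r' - pairForce α β r := by
  have hd : ∀ y ∈ Set.Icc r r', HasDerivAt (pairForce α β) _ y :=
    fun y hy => hasDerivAt_pairForce α β (hr.trans_le hy.1).ne'
  refine (convex_Icc r r').mul_sub_le_image_sub_of_le_deriv
    (fun y hy => (hd y hy).continuousAt.continuousWithinAt)
    (fun y hy => (hd y (interior_subset hy)).differentiableAt.differentiableWithinAt)
    (fun y hy => ?_) r (Set.left_mem_Icc.2 hrr') r' (Set.right_mem_Icc.2 hrr') hrr'
  have hy' := interior_subset hy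
  have hy0 : 0 < y := hr.trans_le hy'.1
  have hy1 : y ≤ 1 := hy'.2.trans hr'
  rw [(hd y hy').deriv]
  have hpow : y ^ (-(β + 2)) ≤ y ^ (-(α + 2)) :=
    Real.rpow_le_rpow_of_exponent_ge hy0 hy1 (by linarith)
  have hone : 1 ≤ y ^ (-(β + 2)) :=
    Real.one_le_rpow_of_pos_of_le_one_of_nonpos hy0 hy1 (by linarith)
  nlinarith

lemma mul_abs_sub_le_abs_pairForce_sub (hβ : 0 < β) (hαβ : β < α) {r' : ℝ} (hr : 0 < r)
    (hr1 : r ≤ 1) (hr' : 0 < r') (hr1' : r' ≤ 1) :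
    (α - β) * |r - r'| ≤ |pairForce α β r - pairForce α β r'| := by
  rcases le_total r' r with h | h
  · rw [abs_of_nonneg (sub_nonneg.2 h)]
    exact (mul_sub_le_pairForce_sub hβ hαβ hr' h hr1).trans (le_abs_self _)
  · rw [abs_sub_comm, abs_of_nonneg (sub_nonneg.2 h), abs_sub_comm (pairForce α β r)]
    exact (mul_sub_le_pairForce_sub hβ hαβ hr h hr1').trans (le_abs_self _)

section FarRange

variable {R : ℝ}

lemma add_one_mul_rpow_le_add_one_mul_rpow (hβ : 0 < β) (hαβ : β < α) (hR : 0 < R)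
    (hRα : (α + 1) * R ^ (-(α - β)) ≤ β + 1) (hr : R ≤ r) :
    (α + 1) * r ^ (-(α + 2)) ≤ (β + 1) * r ^ (-(β + 2)) := by
  have hr0 := hR.trans_le hr
  have hsplit : r ^ (-(α + 2)) = r ^ (-(α - β)) * r ^ (-(β + 2)) := by
    rw [← Real.rpow_add hr0]
    ring_nf
  rw [hsplit, ← mul_assoc]
  gcongr
  refine le_trans ?_ hRα
  have := Real.rpow_le_rpow_of_nonpos hR hr (show -(α - β) ≤ 0 by linarith)
  have : 0 ≤ α + 1 := by linarith
  gcongr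

lemma antitoneOn_pairForce (hβ : 0 < β) (hαβ : β < α) (hR : 0 < R)
    (hRα : (α + 1) * R ^ (-(α - β)) ≤ β + 1) : AntitoneOn (pairForce α β) (Set.Ici R) := by
  have hd : ∀ y ∈ Set.Ici R, HasDerivAt (pairForce α β) _ y :=
    fun y hy => hasDerivAt_pairForce α β (hR.trans_le hy).ne'
  refine antitoneOn_of_deriv_nonpos (convex_Ici R)
    (fun y hy => (hd y hy).continuousAt.continuousWithinAt)
    (fun y hy => (hd y (interior_subset hy)).differentiableAt.differentiableWithinAt)
    fun y hy => ?_
  rw [(hd y (interior_subset hy)).deriv]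
  linarith [add_one_mul_rpow_le_add_one_mul_rpow hβ hαβ hR hRα (interior_subset hy)]

lemma abs_pairForce_sub_le (hβ : 0 < β) (hαβ : β < α) (hR : 0 < R)
    (hRα : (α + 1) * R ^ (-(α - β)) ≤ β + 1) {r' : ℝ} (hr : R ≤ r) (hr' : R ≤ r') :
    |pairForce α β r - pairForce α β r'| ≤ (β + 1) * R ^ (-(β + 2)) * |r - r'| := by
  have hd : ∀ y ∈ Set.Ici R, HasDerivAt (pairForce α β) _ y :=
    fun y hy => hasDerivAt_pairForce α β (hR.trans_le hy).ne'
  refine (convex_Ici R).norm_image_sub_le_of_norm_deriv_le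
    (fun y hy => (hd y hy).differentiableAt) (fun y (hy : R ≤ y) => ?_) hr' hr
  have hy0 : 0 < y := hR.trans_le hy
  have hpow := Real.rpow_le_rpow_of_nonpos hR hy (show -(β + 2) ≤ 0 by linarith)
  have hle := add_one_mul_rpow_le_add_one_mul_rpow hβ hαβ hR hRα hy
  have hnonneg : 0 ≤ (α + 1) * y ^ (-(α + 2)) :=
    mul_nonneg (by linarith) (Real.rpow_nonneg hy0.le _)
  rw [(hd y hy).deriv, Real.norm_eq_abs, abs_sub_comm, abs_of_nonneg (sub_nonneg.2 hle)]
  have : (β + 1) * y ^ (-(β + 2)) ≤ (β + 1) * R ^ (-(β + 2)) := by gcongr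
  linarith

end FarRange

/-! ### Chains on a line -/

/-- The tension of the bond between `p` and `p + 1` in the chain at positions `y 0, …, y (N - 1)`:
the total normalized attraction between the particles on its two sides. -/
noncomputable def bondForce (α β : ℝ) (N : ℕ) (y : ℕ → ℝ) (p : ℕ) : ℝ :=
  ∑ q ∈ pairsAcross p N, pairForce α β (y q.2 - y q.1)

/-- Equilibrium of the chain at positions `y 0 < … < y (N - 1)`: every bond is free of tension.
The values of `y` beyond `N - 1` play no role. -/
structure Balanced (α β : ℝ) (N : ℕ) (y : ℕ → ℝ) : Prop where
  lt_succ : ∀ p, p + 1 < N → y p < y (p + 1)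
  bondForce_eq_zero : ∀ p, p + 1 < N → bondForce α β N y p = 0

variable {y z : ℕ → ℝ}

lemma mul_le_sub_of_le_bonds {m : ℝ} (hm : ∀ p, p + 1 < N → m ≤ y (p + 1) - y p) {i j : ℕ}
    (hij : i ≤ j) (hj : j < N) : ((j - i : ℕ) : ℝ) * m ≤ y j - y i := by
  rw [← Finset.sum_Ico_sub y hij, ← Nat.card_Ico, ← nsmul_eq_mul]
  refine Finset.card_nsmul_le_sum _ _ _ fun l hl => hm l ?_
  rw [Finset.mem_Ico] at hl
  omega

lemma mul_le_sub_of_mem_pairsAcross {m : ℝ} (hm : ∀ p, p + 1 < N → m ≤ y (p + 1) - y p)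
    {q : ℕ × ℕ} (hq : q ∈ pairsAcross p N) : ((q.2 - q.1 : ℕ) : ℝ) * m ≤ y q.2 - y q.1 := by
  rw [mem_pairsAcross] at hq
  exact mul_le_sub_of_le_bonds hm (by omega) hq.2.2

lemma bond_le_sub_of_mem_pairsAcross (hy : ∀ p, p + 1 < N → y p < y (p + 1)) {q : ℕ × ℕ}
    (hq : q ∈ pairsAcross p N) : y (p + 1) - y p ≤ y q.2 - y q.1 := by
  rw [mem_pairsAcross] at hq
  have hpos : ∀ p, p + 1 < N → 0 ≤ y (p + 1) - y p := fun p hp => (sub_pos.2 (hy p hp)).le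
  have hleft := mul_le_sub_of_le_bonds hpos hq.1 (by omega)
  have hright := mul_le_sub_of_le_bonds hpos (show p + 1 ≤ q.2 by omega) hq.2.2
  rw [mul_zero] at hleft hright
  linarith

lemma exists_min_bond (f : ℕ → ℝ) (hp : p + 1 < N) :
    ∃ p₀, p₀ + 1 < N ∧ ∀ l, l + 1 < N → f p₀ ≤ f l := by
  obtain ⟨a, ha, h⟩ := Finset.exists_min_image (Finset.range (N - 1)) f
    ⟨p, Finset.mem_range.2 (by omega)⟩
  simp only [Finset.mem_range] at ha h
  exact ⟨a, by omega, fun l hl => h l (by omega)⟩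

lemma Balanced.bond_le_one (hαβ : β < α) (hy : Balanced α β N y) (hp : p + 1 < N) :
    y (p + 1) - y p ≤ 1 := by
  by_contra! h
  have hpos : 0 < bondForce α β N y p :=
    Finset.sum_pos
      (fun q hq => pairForce_pos hαβ (h.trans_le (bond_le_sub_of_mem_pairsAcross hy.lt_succ hq)))
      ⟨_, self_mem_pairsAcross hp⟩
  exact hpos.ne' (hy.bondForce_eq_zero p hp)

/-- A lower bound on the bond lengths of balanced chains. -/
noncomputable def minBond (α β : ℝ) : ℝ :=
  (1 / zeta β) ^ (1 / (α - β))

/-- The bond length of the infinite chain in equilibrium. -/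
noncomputable def limitBond (α β : ℝ) : ℝ :=
  (zeta α / zeta β) ^ (1 / (α - β))

lemma minBond_pos (hβ : 1 < β) : 0 < minBond α β := by
  have := zeta_pos hβ
  unfold minBond
  positivity

lemma minBond_rpow (hβ : 1 < β) (hαβ : β < α) : minBond α β ^ (-(α - β)) = zeta β := by
  have := zeta_pos hβ
  rw [Real.rpow_neg (minBond_pos hβ).le, minBond, ← Real.rpow_mul (by positivity),
    one_div_mul_cancel (by linarith), Real.rpow_one, one_div, inv_inv]

lemma minBond_le_limitBond (hβ : 1 < β) (hαβ : β < α) : minBond α β ≤ limitBond α β := by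
  have := zeta_pos hβ
  have := one_le_zeta (hβ.trans hαβ)
  unfold minBond limitBond
  have : 0 < α - β := sub_pos.2 hαβ
  gcongr

lemma limitBond_le_one (hβ : 1 < β) (hαβ : β < α) : limitBond α β ≤ 1 := by
  have := zeta_pos hβ
  have := zeta_pos (hβ.trans hαβ)
  refine Real.rpow_le_one (by positivity) ?_ (one_div_nonneg.2 (by linarith))
  exact (div_le_one (by positivity)).2 (antitoneOn_zeta hβ (hβ.trans hαβ) hαβ.le)

lemma limitBond_pos (hβ : 1 < β) (hαβ : β < α) : 0 < limitBond α β :=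
  (minBond_pos hβ).trans_le (minBond_le_limitBond hβ hαβ)

lemma limitBond_rpow (hβ : 1 < β) (hαβ : β < α) : limitBond α β ^ (α - β) = zeta α / zeta β := by
  have := zeta_pos hβ
  have := zeta_pos (hβ.trans hαβ)
  rw [limitBond, ← Real.rpow_mul (by positivity), one_div_mul_cancel (by linarith), Real.rpow_one]

-- The repulsion across the shortest bond has to be compensated by the attraction of all pairs
-- across it, which is largest when all bonds are equal.
lemma Balanced.rpow_neg_le_zeta_of_min (hβ : 1 < β) (hy : Balanced α β N y) (hp : p + 1 < N)
    (hmin : ∀ l, l + 1 < N → y (p + 1) - y p ≤ y (l + 1) - y l) :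
    (y (p + 1) - y p) ^ (-(α - β)) ≤ zeta β := by
  set m := y (p + 1) - y p
  have hm0 : 0 < m := sub_pos.2 (hy.lt_succ _ hp)
  have hrep : m ^ (-(α + 1)) ≤ ∑ q ∈ pairsAcross p N, (y q.2 - y q.1) ^ (-(α + 1)) :=
    Finset.single_le_sum (f := fun q : ℕ × ℕ => (y q.2 - y q.1) ^ (-(α + 1)))
      (fun q hq => Real.rpow_nonneg (hm0.le.trans (bond_le_sub_of_mem_pairsAcross hy.lt_succ hq)) _)
      (self_mem_pairsAcross hp)
  have hatt : ∑ q ∈ pairsAcross p N, (y q.2 - y q.1) ^ (-(β + 1)) ≤ m ^ (-(β + 1)) * zeta β := by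
    refine le_trans ?_ (mul_le_mul_of_nonneg_left (sum_pairsAcross_rpow_le hβ hp) (by positivity))
    rw [Finset.mul_sum]
    refine Finset.sum_le_sum fun q hq => ?_
    have hn := sub_pos_of_mem_pairsAcross hq
    rw [← Real.mul_rpow hm0.le hn.le, mul_comm]
    exact Real.rpow_le_rpow_of_nonpos (by positivity) (mul_le_sub_of_mem_pairsAcross hmin hq)
      (by linarith)
  have hbal := hy.bondForce_eq_zero p hp
  simp only [bondForce, pairForce, Finset.sum_sub_distrib] at hbal
  refine le_of_mul_le_mul_left (a := m ^ (-(β + 1))) ?_ (by positivity)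
  rw [← Real.rpow_add hm0, show -(β + 1) + -(α - β) = -(α + 1) by ring]
  linarith

lemma Balanced.minBond_le_bond (hβ : 1 < β) (hαβ : β < α) (hy : Balanced α β N y)
    (hp : p + 1 < N) : minBond α β ≤ y (p + 1) - y p := by
  obtain ⟨p₀, hp₀, hmin⟩ := exists_min_bond (fun p => y (p + 1) - y p) hp
  refine le_trans ?_ (hmin p hp)
  by_contra! hlt
  have hrpow := Real.rpow_lt_rpow_of_neg (sub_pos.2 (hy.lt_succ p₀ hp₀)) hlt
    (show -(α - β) < 0 by linarith)
  rw [minBond_rpow hβ hαβ] at hrpow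
  exact hrpow.not_ge (hy.rpow_neg_le_zeta_of_min hβ hp₀ hmin)

/-! ### Stiff repulsion -/

/-- The repulsion exponent `α` is so large, depending on `β`, that the forces at distance at least
`2 * minBond α β` are attractive and decreasing, and that the stiffness `α - β` of a bond dominates
its interaction with all the other ones. -/
structure StiffExponent (α β : ℝ) : Prop where
  one_lt : 1 < β
  decreasing : (α + 1) * (2 ^ (-(α - β)) * zeta β) ≤ β + 1
  stiff : (β + 1) * zeta β * convConst β + 1 ≤ α - β

lemma eventually_stiffExponent (hβ : 1 < β) : ∀ᶠ α in Filter.atTop, StiffExponent α β := by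
  have hexp : ∀ s : ℝ, Filter.Tendsto (fun α : ℝ => α ^ s * (2 : ℝ) ^ (-α)) Filter.atTop (nhds 0) :=
    fun s => (tendsto_rpow_mul_exp_neg_mul_atTop_nhds_zero s (Real.log 2)
      (Real.log_pos one_lt_two)).congr fun α => by rw [Real.rpow_def_of_pos two_pos]; ring_nf
  have hlim : Filter.Tendsto (fun α : ℝ => (α + 1) * ((2 : ℝ) ^ (-(α - β)) * zeta β))
      Filter.atTop (nhds 0) := by
    have h := ((hexp 1).add (hexp 0)).mul_const (2 ^ β * zeta β)
    rw [zero_add, zero_mul] at h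
    refine h.congr fun α => ?_
    rw [neg_sub, sub_eq_neg_add, Real.rpow_add two_pos, Real.rpow_one, Real.rpow_zero]
    ring
  filter_upwards [hlim.eventually_le_const (show 0 < β + 1 by linarith),
    Filter.eventually_ge_atTop ((β + 1) * zeta β * convConst β + 1 + β)] with α hdecr hstiff
  exact ⟨hβ, hdecr, by linarith⟩

namespace StiffExponent

variable (h : StiffExponent α β)

include h

lemma two_mul_add_two_le : 2 * β + 2 ≤ α := by
  have hβ := h.one_lt
  have hζ := one_le_zeta hβ
  have hβ' : 0 < β - 1 := by linarith
  have hconv : 1 ≤ convConst β :=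
    one_le_mul_of_one_le_of_one_le (Real.one_le_rpow one_le_two hβ'.le)
      (hζ.trans (le_add_of_nonneg_right (by positivity)))
  have hone : 1 ≤ zeta β * convConst β := one_le_mul_of_one_le_of_one_le hζ hconv
  nlinarith [h.stiff]

lemma lt : β < α := by
  linarith [h.one_lt, h.two_mul_add_two_le]

lemma minBond_le_one : minBond α β ≤ 1 :=
  (minBond_le_limitBond h.one_lt h.lt).trans (limitBond_le_one h.one_lt h.lt)

lemma minBond_rpow_neg_le {s : ℝ} (hs : s ≤ β + 2) : minBond α β ^ (-s) ≤ zeta β := by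
  rw [← minBond_rpow h.one_lt h.lt]
  exact Real.rpow_le_rpow_of_exponent_ge (minBond_pos h.one_lt) h.minBond_le_one
    (by linarith [h.two_mul_add_two_le])

variable {n : ℕ} (hn : 2 ≤ n)

include hn

lemma mul_minBond_rpow_le :
    ((n : ℝ) * minBond α β) ^ (-(α - β)) ≤ 2 ^ (-(α - β)) * zeta β := by
  have hζ := zeta_pos h.one_lt
  rw [Real.mul_rpow (by positivity) (minBond_pos h.one_lt).le, minBond_rpow h.one_lt h.lt]
  exact mul_le_mul_of_nonneg_right
    (Real.rpow_le_rpow_of_nonpos two_pos (by exact_mod_cast hn) (by linarith [h.lt])) hζ.le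

lemma mul_minBond_pos : 0 < (n : ℝ) * minBond α β :=
  mul_pos (by exact_mod_cast (by omega)) (minBond_pos h.one_lt)

lemma add_one_mul_rpow_le : (α + 1) * ((n : ℝ) * minBond α β) ^ (-(α - β)) ≤ β + 1 :=
  (mul_le_mul_of_nonneg_left (h.mul_minBond_rpow_le hn) (by linarith [h.one_lt, h.lt])).trans
    h.decreasing

lemma antitoneOn_pairForce : AntitoneOn (pairForce α β) (Set.Ici (n * minBond α β)) :=
  MagneticChain.antitoneOn_pairForce (by linarith [h.one_lt]) h.lt (h.mul_minBond_pos hn)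
    (h.add_one_mul_rpow_le hn)

lemma abs_pairForce_sub_le {r' : ℝ} (hr : n * minBond α β ≤ r) (hr' : n * minBond α β ≤ r') :
    |pairForce α β r - pairForce α β r'| ≤
      (β + 1) * zeta β * (n : ℝ) ^ (-(β + 2)) * |r - r'| := by
  have hβ := h.one_lt
  have hu := minBond_pos (α := α) hβ
  refine (MagneticChain.abs_pairForce_sub_le (by linarith) h.lt (h.mul_minBond_pos hn)
    (h.add_one_mul_rpow_le hn) hr hr').trans ?_
  rw [Real.mul_rpow (by positivity) hu.le, mul_assoc (β + 1) (zeta β), mul_comm (zeta β)]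
  gcongr
  exact h.minBond_rpow_neg_le le_rfl

lemma half_mul_rpow_le_pairForce (hr : n * minBond α β ≤ r) (hrn : r ≤ n) :
    1 / 2 * (n : ℝ) ^ (-(β + 1)) ≤ pairForce α β r := by
  have hβ := h.one_lt
  have hr0 := (h.mul_minBond_pos hn).trans_le hr
  have hhalf : r ^ (-(α - β)) ≤ 1 / 2 := by
    refine (Real.rpow_le_rpow_of_nonpos (h.mul_minBond_pos hn) hr (by linarith [h.lt])).trans ?_
    nlinarith [h.add_one_mul_rpow_le hn, h.two_mul_add_two_le]
  have hpow : (n : ℝ) ^ (-(β + 1)) ≤ r ^ (-(β + 1)) :=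
    Real.rpow_le_rpow_of_nonpos hr0 hrn (by linarith)
  rw [pairForce_eq_mul_one_sub _ _ hr0, mul_comm]
  have : 1 / 2 ≤ 1 - r ^ (-(α - β)) := by linarith
  gcongr

end StiffExponent

/-! ### Stability of the bonds -/

lemma abs_sub_sum_le_abs_sum {ι : Type*} {s : Finset ι} {F G : ι → ℝ} {i : ι}
    (hi : i ∈ s) (hG : 0 ≤ G i) (hF : ∀ j ∈ s, j ≠ i → |F j| ≤ G j) :
    |F i| - ∑ j ∈ s, G j ≤ |∑ j ∈ s, F j| := by
  classical
  have herase : |∑ j ∈ s.erase i, F j| ≤ ∑ j ∈ s.erase i, G j :=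
    (Finset.abs_sum_le_sum_abs _ _).trans <| Finset.sum_le_sum fun j hj =>
      hF j (Finset.mem_of_mem_erase hj) (Finset.ne_of_mem_erase hj)
  rw [← Finset.add_sum_erase s F hi, ← Finset.add_sum_erase s G hi]
  have := abs_sub_abs_le_abs_add (F i) (∑ j ∈ s.erase i, F j)
  linarith

lemma StiffExponent.abs_pairForce_sub_le_sum (h : StiffExponent α β)
    (hy : ∀ l, l + 1 < N → minBond α β ≤ y (l + 1) - y l)
    (hz : ∀ l, l + 1 < N → minBond α β ≤ z (l + 1) - z l) {w : ℕ → ℝ}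
    (hw : ∀ l, l + 1 < N → |(y (l + 1) - y l) - (z (l + 1) - z l)| ≤ w l)
    {q : ℕ × ℕ} (hq : q ∈ pairsAcross p N) (hne : q ≠ (p, p + 1)) :
    |pairForce α β (y q.2 - y q.1) - pairForce α β (z q.2 - z q.1)| ≤
      (β + 1) * zeta β * (((q.2 - q.1 : ℕ) : ℝ) ^ (-(β + 2)) * ∑ l ∈ Finset.Ico q.1 q.2, w l) := by
  have hβ := h.one_lt
  have hζ := zeta_pos hβ
  have hle : q.1 ≤ q.2 := by
    rw [mem_pairsAcross] at hq
    omega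
  have hdiff : |(y q.2 - y q.1) - (z q.2 - z q.1)| ≤ ∑ l ∈ Finset.Ico q.1 q.2, w l := by
    rw [← Finset.sum_Ico_sub y hle, ← Finset.sum_Ico_sub z hle, ← Finset.sum_sub_distrib]
    refine (Finset.abs_sum_le_sum_abs _ _).trans (Finset.sum_le_sum fun l hl => hw l ?_)
    rw [mem_pairsAcross] at hq
    rw [Finset.mem_Ico] at hl
    omega
  refine (h.abs_pairForce_sub_le (two_le_sub_of_mem_pairsAcross hq hne)
    (mul_le_sub_of_mem_pairsAcross hy hq) (mul_le_sub_of_mem_pairsAcross hz hq)).trans ?_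
  rw [mul_assoc ((β + 1) * zeta β)]
  gcongr

-- A maximum principle: where the difference of the bonds is largest relative to `endEffect`, the
-- stiffness of that bond alone outweighs the response of all the other ones.
theorem StiffExponent.abs_bond_sub_le (h : StiffExponent α β)
    (hy : ∀ l, l + 1 < N → minBond α β ≤ y (l + 1) - y l ∧ y (l + 1) - y l ≤ 1)
    (hz : ∀ l, l + 1 < N → minBond α β ≤ z (l + 1) - z l ∧ z (l + 1) - z l ≤ 1) {D : ℝ}
    (hD : ∀ l, l + 1 < N →
      |bondForce α β N y l - bondForce α β N z l| ≤ D * endEffect β N l) (hp : p + 1 < N) :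
    |(y (p + 1) - y p) - (z (p + 1) - z p)| ≤ D * endEffect β N p := by
  have hβ := h.one_lt
  have hζ := zeta_pos hβ
  set d : ℕ → ℝ := fun l => |(y (l + 1) - y l) - (z (l + 1) - z l)|
  obtain ⟨k, hk, hmax⟩ := exists_min_bond (fun l => -(d l / endEffect β N l)) hp
  set R := d k / endEffect β N k
  have hR0 : 0 ≤ R := div_nonneg (abs_nonneg _) endEffect_pos.le
  have hw : ∀ l, l + 1 < N → d l ≤ R * endEffect β N l := fun l hl =>
    (div_le_iff₀ endEffect_pos).1 (neg_le_neg_iff.1 (hmax l hl))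
  have hdk : d k = R * endEffect β N k := (div_mul_cancel₀ _ endEffect_pos.ne').symm
  have hu := minBond_pos (α := α) hβ
  have hself := mul_abs_sub_le_abs_pairForce_sub (by linarith) h.lt (hu.trans_le (hy k hk).1)
    (hy k hk).2 (hu.trans_le (hz k hk).1) (hz k hk).2
  have hothers := abs_sub_sum_le_abs_sum (self_mem_pairsAcross hk)
    (mul_nonneg (by positivity) (mul_nonneg (by positivity)
      (Finset.sum_nonneg fun l _ => mul_nonneg hR0 endEffect_pos.le)))
    fun q hq hne => h.abs_pairForce_sub_le_sum (fun l hl => (hy l hl).1) (fun l hl => (hz l hl).1)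
      hw hq hne
  simp only [Finset.sum_sub_distrib, ← Finset.mul_sum, mul_left_comm _ R] at hothers
  have hconv := mul_le_mul_of_nonneg_left (sum_pairsAcross_endEffect_le hβ hk)
    (show 0 ≤ R * ((β + 1) * zeta β) by positivity)
  have hRD : R * endEffect β N k ≤ D * endEffect β N k := by
    have hstiff := mul_le_mul_of_nonneg_right h.stiff
      (mul_nonneg hR0 (endEffect_pos (β := β) (N := N) (l := k)).le)
    have hforce := hD k hk
    change (α - β) * d k ≤ _ at hself
    rw [hdk] at hself
    unfold bondForce at hforce
    linarith
  exact (hw p hp).trans (mul_le_mul_of_nonneg_right (le_of_mul_le_mul_right hRD endEffect_pos)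
    endEffect_pos.le)

theorem Balanced.bond_eq (h : StiffExponent α β) (hy : Balanced α β N y) (hz : Balanced α β N z)
    (hp : p + 1 < N) : y (p + 1) - y p = z (p + 1) - z p := by
  have hdiff := h.abs_bond_sub_le (D := 0)
    (fun l hl => ⟨hy.minBond_le_bond h.one_lt h.lt hl, hy.bond_le_one h.lt hl⟩)
    (fun l hl => ⟨hz.minBond_le_bond h.one_lt h.lt hl, hz.bond_le_one h.lt hl⟩)
    (fun l hl => by simp [hy.bondForce_eq_zero l hl, hz.bondForce_eq_zero l hl]) hp
  rw [zero_mul, abs_nonpos_iff, sub_eq_zero] at hdiff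
  exact hdiff

/-! ### Comparison with the infinite chain -/

lemma hasSum_mul_pairForce (hβ : 1 < β) (hαβ : β < α) {m : ℝ} (hm : 0 < m) :
    HasSum (fun n : ℕ => (n : ℝ) * pairForce α β (n * m))
      (m ^ (-(β + 1)) * zeta β * (1 - (limitBond α β / m) ^ (α - β))) := by
  have hζ := zeta_pos hβ
  have hsum := ((hasSum_zeta hβ).mul_left (m ^ (-(β + 1)))).sub
    ((hasSum_zeta (hβ.trans hαβ)).mul_left (m ^ (-(α + 1))))
  have hterm : ∀ s : ℝ, s ≠ 0 → ∀ n : ℕ,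
      m ^ (-(s + 1)) * (n : ℝ) ^ (-s) = n * (n * m) ^ (-(s + 1)) := fun s hs n => by
    rw [Real.mul_rpow n.cast_nonneg hm.le, ← mul_assoc, mul_rpow_neg_add_one n.cast_nonneg hs,
      mul_comm]
  have hvalue : m ^ (-(β + 1)) * zeta β * (1 - (limitBond α β / m) ^ (α - β)) =
      m ^ (-(β + 1)) * zeta β - m ^ (-(α + 1)) * zeta α := by
    rw [Real.div_rpow (limitBond_pos hβ hαβ).le hm.le, limitBond_rpow hβ hαβ,
      show -(α + 1) = -(β + 1) - (α - β) by ring, Real.rpow_sub hm _ (α - β)]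
    field_simp
  rw [hvalue]
  refine hsum.congr_fun fun n => ?_
  rw [hterm β (by linarith), hterm α (by linarith), ← mul_sub, pairForce]

lemma StiffExponent.abs_bondForce_limitBond_le (h : StiffExponent α β) (hp : p + 1 < N) :
    |bondForce α β N (fun i => i * limitBond α β) p| ≤
      zeta β * (β / (β - 1)) * endEffect β N p := by
  have hβ := h.one_lt
  set s := limitBond α β
  have hs0 : 0 < s := limitBond_pos hβ h.lt
  have hs1 : s ≤ 1 := limitBond_le_one hβ h.lt
  have hus : minBond α β ≤ s := minBond_le_limitBond hβ h.lt
  have hdist : bondForce α β N (fun i => i * s) p =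
      ∑ q ∈ pairsAcross p N, pairForce α β ((q.2 - q.1 : ℕ) * s) :=
    Finset.sum_congr rfl fun q hq => by
      rw [mem_pairsAcross] at hq
      rw [Nat.cast_sub (by omega), sub_mul]
  have hbulk := hasSum_mul_pairForce hβ h.lt hs0
  rw [div_self hs0.ne', Real.one_rpow, sub_self, mul_zero] at hbulk
  rw [hdist, ← sub_zero (∑ q ∈ pairsAcross p N, _)]
  refine abs_sum_pairsAcross_sub_le hβ hp hbulk
    (fun n hn => le_trans (by positivity) (h.half_mul_rpow_le_pairForce hn
      (by gcongr) (mul_le_of_le_one_right n.cast_nonneg hs1))) fun n _ => ?_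
  calc (n : ℝ) * pairForce α β (n * s) ≤ n * (n * s) ^ (-(β + 1)) := by
        gcongr
        exact pairForce_le (by positivity)
    _ = s ^ (-(β + 1)) * (n : ℝ) ^ (-β) := by
        rw [Real.mul_rpow n.cast_nonneg hs0.le, ← mul_assoc,
          mul_rpow_neg_add_one n.cast_nonneg (by linarith), mul_comm]
    _ ≤ zeta β * (n : ℝ) ^ (-β) := by
        gcongr
        exact (Real.rpow_le_rpow_of_nonpos (minBond_pos hβ) hus (by linarith)).trans
          (h.minBond_rpow_neg_le (by linarith))

theorem Balanced.bond_le_limitBond_add (h : StiffExponent α β) (hy : Balanced α β N y)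
    (hp : p + 1 < N) :
    y (p + 1) - y p ≤ limitBond α β + zeta β * (β / (β - 1)) * endEffect β N p := by
  have hβ := h.one_lt
  have hbond : ∀ l : ℕ, ((l + 1 : ℕ) : ℝ) * limitBond α β - l * limitBond α β = limitBond α β :=
    fun l => by
      push_cast
      ring
  have hdiff := h.abs_bond_sub_le (z := fun i => i * limitBond α β)
    (fun l hl => ⟨hy.minBond_le_bond hβ h.lt hl, hy.bond_le_one h.lt hl⟩)
    (fun l _ => by
      rw [hbond]
      exact ⟨minBond_le_limitBond hβ h.lt, limitBond_le_one hβ h.lt⟩)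
    (fun l hl => by
      rw [hy.bondForce_eq_zero l hl, zero_sub, abs_neg]
      exact h.abs_bondForce_limitBond_le hl) hp
  rw [hbond] at hdiff
  linarith [le_abs_self (y (p + 1) - y p - limitBond α β)]

lemma mul_one_sub_rpow_le {m s : ℝ} (hm : 0 < m) (hs : 0 ≤ s) (hβ : 0 < β) (hαβ : β + 1 ≤ α) :
    m ^ (-(β + 1)) * (1 - (s / m) ^ (α - β)) ≤ m ^ (-(β + 2)) * ((α - β) * (m - s)) := by
  have hbern := one_add_mul_self_le_rpow_one_add (s := s / m - 1) (p := α - β)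
    (by linarith [div_nonneg hs hm.le]) (by linarith)
  rw [add_sub_cancel] at hbern
  calc m ^ (-(β + 1)) * (1 - (s / m) ^ (α - β)) ≤ m ^ (-(β + 1)) * ((α - β) * (1 - s / m)) := by
        gcongr
        linarith
    _ = m ^ (-(β + 2)) * ((α - β) * (m - s)) := by
        rw [show β + 2 = β + 1 + 1 by ring, ← mul_rpow_neg_add_one hm.le (by linarith)]
        field_simp

-- The force balance of the shortest bond lacks the attraction of particles beyond the ends.
lemma Balanced.le_bulkForce_of_min (h : StiffExponent α β) (hy : Balanced α β N y) (hp : p + 1 < N)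
    (hmin : ∀ l, l + 1 < N → y (p + 1) - y p ≤ y (l + 1) - y l) {m : ℝ} (hm : m = y (p + 1) - y p) :
    1 / 2 * (2 ^ (-β) * (N : ℝ) ^ (1 - β)) ≤
      m ^ (-(β + 1)) * zeta β * (1 - (limitBond α β / m) ^ (α - β)) := by
  have hβ := h.one_lt
  rw [← hm] at hmin
  have hum : minBond α β ≤ m := hm ▸ hy.minBond_le_bond hβ h.lt hp
  have hm0 : 0 < m := (minBond_pos hβ).trans_le hum
  have hfar : ∀ n : ℕ, 2 ≤ n → 1 / 2 * (n : ℝ) ^ (-(β + 1)) ≤ pairForce α β (n * m) := fun n hn =>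
    h.half_mul_rpow_le_pairForce hn (by gcongr)
      (mul_le_of_le_one_right n.cast_nonneg (hm ▸ hy.bond_le_one h.lt hp))
  have hnonneg : ∀ n : ℕ, 2 ≤ n → 0 ≤ pairForce α β (n * m) := fun n hn =>
    le_trans (by positivity) (hfar n hn)
  have hshort : 0 ≤ ∑ n ∈ Finset.range N, (n : ℝ) * pairForce α β (n * m) := by
    refine le_trans ?_
      (sum_pairsAcross_dist_le hp (F := fun n : ℕ => pairForce α β (n * m)) hnonneg)
    rw [← hy.bondForce_eq_zero p hp]
    refine Finset.sum_le_sum fun q hq => ?_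
    rcases eq_or_ne q (p, p + 1) with rfl | hne
    · simp [hm]
    have hle := mul_le_sub_of_mem_pairsAcross hmin hq
    have hn := two_le_sub_of_mem_pairsAcross hq hne
    have hnum : ((q.2 - q.1 : ℕ) : ℝ) * minBond α β ≤ (q.2 - q.1 : ℕ) * m := by gcongr
    exact h.antitoneOn_pairForce hn hnum (hnum.trans hle) hle
  have hbulk := sum_le_hasSum (Finset.range (2 * N)) (fun n hn => by
    rw [Finset.mem_range] at hn
    exact mul_nonneg n.cast_nonneg (hnonneg n (by omega))) (hasSum_mul_pairForce hβ h.lt hm0)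
  rw [← Finset.sum_range_add_sum_Ico _ (show N ≤ 2 * N by omega)] at hbulk
  have htail : 1 / 2 * ∑ n ∈ Finset.Ico N (2 * N), (n : ℝ) ^ (-β) ≤
      ∑ n ∈ Finset.Ico N (2 * N), (n : ℝ) * pairForce α β (n * m) := by
    rw [Finset.mul_sum]
    refine Finset.sum_le_sum fun n hn => ?_
    rw [← mul_rpow_neg_add_one n.cast_nonneg (by linarith), mul_left_comm]
    gcongr
    exact hfar n (by have := (Finset.mem_Ico.1 hn).1; omega)
  linarith [le_sum_Ico_rpow_neg (show 0 ≤ β by linarith) (show 1 ≤ N by omega)]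

theorem exists_limitBond_add_le (h : StiffExponent α β) : ∃ c : ℝ, 0 < c ∧
    ∀ (N : ℕ) (y : ℕ → ℝ), Balanced α β N y → ∀ p, p + 1 < N →
      limitBond α β + c * (N : ℝ) ^ (1 - β) ≤ y (p + 1) - y p := by
  have hβ := h.one_lt
  have hζ := zeta_pos hβ
  have hαβ : 0 < α - β := sub_pos.2 h.lt
  refine ⟨1 / 2 * 2 ^ (-β) / (zeta β * (zeta β * (α - β))), by positivity, fun N y hy p hp => ?_⟩
  obtain ⟨p₀, hp₀, hmin⟩ := exists_min_bond (fun p => y (p + 1) - y p) hp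
  refine le_trans ?_ (hmin p hp)
  have hforce := hy.le_bulkForce_of_min h hp₀ hmin rfl
  have hum := hy.minBond_le_bond hβ h.lt hp₀
  set m := y (p₀ + 1) - y p₀
  set s := limitBond α β
  have hm0 : 0 < m := (minBond_pos hβ).trans_le hum
  have hlin := mul_one_sub_rpow_le hm0 (limitBond_pos hβ h.lt).le (by linarith)
    (show β + 1 ≤ α by linarith [h.two_mul_add_two_le])
  have hpow : m ^ (-(β + 2)) ≤ zeta β :=
    (Real.rpow_le_rpow_of_nonpos (minBond_pos hβ) hum (by linarith)).trans
      (h.minBond_rpow_neg_le le_rfl)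
  have hend : 1 / 2 * (2 ^ (-β) * (N : ℝ) ^ (1 - β)) ≤
      m ^ (-(β + 2)) * (zeta β * (α - β) * (m - s)) := by
    have := mul_le_mul_of_nonneg_right hlin hζ.le
    linarith
  have hNpos : 0 ≤ 1 / 2 * (2 ^ (-β) * (N : ℝ) ^ (1 - β)) := by positivity
  have hsm : 0 ≤ zeta β * (α - β) * (m - s) :=
    nonneg_of_mul_nonneg_right (hNpos.trans hend) (by positivity)
  rw [div_mul_eq_mul_div, ← le_sub_iff_add_le', div_le_iff₀ (by positivity)]
  linarith [mul_le_mul_of_nonneg_right hpow hsm]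

/-! ### First variation of the energy -/

/-- The attraction between two aligned particles at distance `r`, as the derivative of their
energy. -/
noncomputable def axialForce (A B α β r : ℝ) : ℝ :=
  β * B * r ^ (-(β + 1)) - α * A * r ^ (-(α + 1))

section InnerProductSpace

variable {E : Type*} [NormedAddCommGroup E] [InnerProductSpace ℝ E] {f : ℝ → E} {v : E} {t : ℝ}

lemma inner_eq_zero_of_hasDerivAt_of_norm_eq {c : ℝ} (hf : HasDerivAt f v t)
    (hc : ∀ s, ‖f s‖ = c) : inner ℝ (f t) v = 0 := by
  have hsq := hf.norm_sq
  simp only [hc] at hsq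
  linarith [hsq.unique (hasDerivAt_const t (c ^ 2))]

lemma hasDerivAt_norm_rpow_inv (hf : HasDerivAt f v t) (h0 : f t ≠ 0) (s : ℝ) :
    HasDerivAt (fun t => (‖f t‖ ^ s)⁻¹) (-(s * ‖f t‖ ^ (-(s + 2)) * inner ℝ (f t) v)) t := by
  have hnorm : 0 < ‖f t‖ := norm_pos_iff.2 h0
  have hpow := hf.norm_sq.rpow_const (p := -s / 2) (Or.inl (by positivity))
  have hsq : ∀ r u : ℝ, 0 ≤ r → (r ^ 2) ^ u = r ^ (2 * u) := fun r u hr => by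
    rw [Real.rpow_mul hr, Real.rpow_two]
  have hfun : ∀ s' : ℝ, (‖f s'‖ ^ 2) ^ (-s / 2) = (‖f s'‖ ^ s)⁻¹ := fun s' => by
    rw [hsq _ _ (norm_nonneg _), ← Real.rpow_neg (norm_nonneg _), mul_div_cancel₀ _ two_ne_zero]
  simp only [hfun] at hpow
  refine hpow.congr_deriv ?_
  rw [hsq _ _ hnorm.le, show 2 * (-s / 2 - 1) = -(s + 2) by ring]
  ring

end InnerProductSpace

lemma single_sub_single (x y : ℝ) :
    (EuclideanSpace.single 0 x : E3) - EuclideanSpace.single 0 y =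
      EuclideanSpace.single 0 (x - y) := by
  ext i
  fin_cases i <;> simp

lemma inner_axisSpin (w : E3) : inner ℝ (axisSpin : E3) w = w 0 := by
  simp [axisSpin, EuclideanSpace.inner_single_left]

lemma axial_velocity_eq_zero {m : ℝ → S2} {μ : E3} (hm : HasDerivAt (fun t => (m t : E3)) μ 0)
    (hm0 : m 0 = axisSpin) : μ 0 = 0 := by
  have horth := inner_eq_zero_of_hasDerivAt_of_norm_eq hm fun t => norm_eq_of_mem_sphere (m t)
  rwa [hm0, inner_axisSpin] at horth

lemma hasDerivAt_inner_spin {m : ℝ → S2} {f : ℝ → E3} {w : E3} {ρ : ℝ}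
    (hm : DifferentiableAt ℝ (fun t => (m t : E3)) 0) (hm0 : m 0 = axisSpin)
    (hf : HasDerivAt f w 0) (hf0 : f 0 = EuclideanSpace.single 0 ρ) :
    HasDerivAt (fun t => inner ℝ (m t : E3) (f t)) (w 0) 0 := by
  refine (hm.hasDerivAt.inner ℝ hf).congr_deriv ?_
  rw [hm0, hf0, inner_axisSpin, EuclideanSpace.inner_single_right,
    axial_velocity_eq_zero hm.hasDerivAt hm0]
  simp

section AlignedPair

variable {a b : ℝ → E3 × S2} {v v' : E3} {x x' : ℝ}

lemma hasDerivAt_norm_rpow_inv_of_aligned (ha : HasDerivAt (fun t => (a t).1) v 0)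
    (hb : HasDerivAt (fun t => (b t).1) v' 0) (ha0 : a 0 = (EuclideanSpace.single 0 x, axisSpin))
    (hb0 : b 0 = (EuclideanSpace.single 0 x', axisSpin)) (hx : x' < x) (s : ℝ) :
    HasDerivAt (fun t => (‖(a t).1 - (b t).1‖ ^ s)⁻¹)
      (-(s * (x - x') ^ (-(s + 1)) * (v 0 - v' 0))) 0 := by
  have hpos : 0 < x - x' := sub_pos.2 hx
  have hr0 : (a 0).1 - (b 0).1 = EuclideanSpace.single 0 (x - x') := by
    rw [ha0, hb0, single_sub_single]
  have hnorm : ‖(a 0).1 - (b 0).1‖ = x - x' := by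
    rw [hr0, PiLp.norm_single, Real.norm_of_nonneg hpos.le]
  refine (hasDerivAt_norm_rpow_inv (ha.fun_sub hb)
    (norm_pos_iff.1 (hnorm.symm ▸ hpos)) s).congr_deriv ?_
  rw [hnorm, hr0, EuclideanSpace.inner_single_left, show -(s + 2) = -(s + 1) - 1 by ring,
    Real.rpow_sub_one hpos.ne']
  simp only [conj_trivial, PiLp.sub_apply]
  field_simp

lemma hasDerivAt_repulsivePair (A α : ℝ) (ha : HasDerivAt (fun t => (a t).1) v 0)
    (hb : HasDerivAt (fun t => (b t).1) v' 0) (ha0 : a 0 = (EuclideanSpace.single 0 x, axisSpin))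
    (hb0 : b 0 = (EuclideanSpace.single 0 x', axisSpin)) (hx : x' < x) :
    HasDerivAt (fun t => repulsivePair A α (a t) (b t))
      (-(α * A * (x - x') ^ (-(α + 1)) * (v 0 - v' 0))) 0 := by
  simp only [repulsivePair, one_div]
  refine ((hasDerivAt_norm_rpow_inv_of_aligned ha hb ha0 hb0 hx α).const_mul A).congr_deriv ?_
  ring

-- The spins stay on the sphere, so to first order only the axial velocities change the energy.
lemma hasDerivAt_dipolarPair (B B₀ β : ℝ) (ha : HasDerivAt (fun t => (a t).1) v 0)
    (hb : HasDerivAt (fun t => (b t).1) v' 0)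
    (hma : DifferentiableAt ℝ (fun t => ((a t).2 : E3)) 0)
    (hmb : DifferentiableAt ℝ (fun t => ((b t).2 : E3)) 0)
    (ha0 : a 0 = (EuclideanSpace.single 0 x, axisSpin))
    (hb0 : b 0 = (EuclideanSpace.single 0 x', axisSpin)) (hx : x' < x) :
    HasDerivAt (fun t => dipolarPair B B₀ β (a t) (b t))
      (β * B * (x - x') ^ (-(β + 1)) * (v 0 - v' 0)) 0 := by
  have hpos : 0 < x - x' := sub_pos.2 hx
  have hma0 : (a 0).2 = axisSpin := by rw [ha0]
  have hmb0 : (b 0).2 = axisSpin := by rw [hb0]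
  have hr := ha.fun_sub hb
  have hr0 : (a 0).1 - (b 0).1 = EuclideanSpace.single 0 (x - x') := by
    rw [ha0, hb0, single_sub_single]
  have hspins := (hasDerivAt_inner_spin hma hma0 hmb.hasDerivAt (congrArg Subtype.val hmb0)).mul
    (hasDerivAt_norm_rpow_inv_of_aligned ha hb ha0 hb0 hx β)
  have haxial := ((hasDerivAt_inner_spin hma hma0 hr hr0).mul
    (hasDerivAt_inner_spin hmb hmb0 hr hr0)).mul
    (hasDerivAt_norm_rpow_inv_of_aligned ha hb ha0 hb0 hx (β + 2))
  simp only [dipolarPair, div_eq_mul_inv]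
  refine ((hspins.const_mul B₀).sub (haxial.const_mul (B + B₀))).congr_deriv ?_
  have hnorm : ‖(a 0).1 - (b 0).1‖ = x - x' := by
    rw [hr0, PiLp.norm_single, Real.norm_of_nonneg hpos.le]
  have hpow : (x - x') ^ (-(β + 2)) = (x - x') ^ (-(β + 1)) / (x - x') := by
    rw [← Real.rpow_sub_one hpos.ne']
    ring_nf
  have hpow' : (x - x') ^ (-(β + 2 + 1)) = (x - x') ^ (-(β + 1)) / (x - x') / (x - x') := by
    rw [← Real.rpow_sub_one hpos.ne', ← Real.rpow_sub_one hpos.ne']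
    ring_nf
  simp only [Pi.mul_apply, hma0, hmb0, inner_axisSpin, hnorm,
    axial_velocity_eq_zero hmb.hasDerivAt hmb0, ← Real.rpow_neg hpos.le, hpow, hpow']
  simp only [hr0, axisSpin, PiLp.single_eq_same, PiLp.sub_apply]
  field_simp
  ring

end AlignedPair

section Spear

variable {A B B₀ : ℝ} {P : Fin N → ℝ}

lemma hasDerivAt_energy (A B B₀ α β : ℝ) (hP : StrictMono P) {γ : ℝ → Config N}
    (h0 : γ 0 = spear P) {v : Fin N → E3} (hx : ∀ k, HasDerivAt (fun t => (γ t k).1) (v k) 0)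
    (hm : ∀ k, DifferentiableAt ℝ (fun t => ((γ t k).2 : E3)) 0) :
    HasDerivAt (fun t => energy A B B₀ α β (γ t))
      (∑ k, ∑ l ∈ Finset.Iio k, axialForce A B α β (P k - P l) * (v k 0 - v l 0)) 0 := by
  have h0' : ∀ k, γ 0 k = (EuclideanSpace.single 0 (P k), axisSpin) := congrFun h0
  simp only [energy, ← Finset.sum_add_distrib]
  refine HasDerivAt.fun_sum fun k _ => HasDerivAt.fun_sum fun l hl => ?_
  have hlk := hP (Finset.mem_Iio.1 hl)
  refine ((hasDerivAt_dipolarPair B B₀ β (hx k) (hx l) (hm k) (hm l) (h0' k) (h0' l) hlk).add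
    (hasDerivAt_repulsivePair A α (hx k) (hx l) (h0' k) (h0' l) hlk)).congr_deriv ?_
  rw [axialForce]
  ring

lemma hasDerivAt_single_add_mul (x v : ℝ) :
    HasDerivAt (fun t : ℝ => (EuclideanSpace.single 0 (x + t * v) : E3))
      (EuclideanSpace.single 0 v) 0 := by
  have hline : ∀ t : ℝ, (EuclideanSpace.single 0 (x + t * v) : E3) =
      EuclideanSpace.single 0 x + t • EuclideanSpace.single 0 v := fun t => by
    ext i
    fin_cases i <;> simp
  simp only [hline]
  simpa using ((hasDerivAt_id (0 : ℝ)).smul_const (EuclideanSpace.single 0 v : E3)).const_add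
    (EuclideanSpace.single 0 x)

lemma hasDerivAt_energy_spear (A B B₀ α β : ℝ) (hP : StrictMono P) (v : Fin N → ℝ) :
    HasDerivAt (fun t : ℝ => energy A B B₀ α β (spear fun k => P k + t * v k))
      (∑ k, ∑ l ∈ Finset.Iio k, axialForce A B α β (P k - P l) * (v k - v l)) 0 := by
  simpa using hasDerivAt_energy A B B₀ α β hP (γ := fun t => spear fun k => P k + t * v k)
    (by simp) (fun k => hasDerivAt_single_add_mul (P k) (v k)) fun _ => differentiableAt_const _

lemma collisionFree_spear_iff : CollisionFree (spear P) ↔ Function.Injective P := by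
  refine forall₂_congr fun k l => imp_congr_left ⟨fun h => ?_, fun h => by simp [spear, h]⟩
  simpa [spear] using congrArg (fun w : E3 => w 0) h

lemma IsCriticalSpear.strictMono (h : IsCriticalSpear A B B₀ α β P) : StrictMono P :=
  h.1.strictMono_of_injective (collisionFree_spear_iff.1 h.2.1)

theorem isCriticalPoint_spear_iff (hP : StrictMono P) :
    IsCriticalPoint A B B₀ α β (spear P) ↔ ∀ v : Fin N → ℝ,
      ∑ k, ∑ l ∈ Finset.Iio k, axialForce A B α β (P k - P l) * (v k - v l) = 0 := by
  refine ⟨fun h v => ?_, fun h => ⟨collisionFree_spear_iff.2 hP.injective, fun γ h0 hx hm => ?_⟩⟩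
  · exact (hasDerivAt_energy_spear A B B₀ α β hP v).unique
      (h.2 (fun t => spear fun k => P k + t * v k) (by simp)
        (fun k => (hasDerivAt_single_add_mul (P k) (v k)).differentiableAt)
        fun _ => differentiableAt_const _)
  · have hderiv := hasDerivAt_energy A B B₀ α β hP h0 (fun k => (hx k).hasDerivAt) hm
    rwa [h fun k => deriv (fun t => (γ t k).1) 0 0] at hderiv

end Spear

/-! ### Normalization of critical spears -/

section Normalization

variable {A B B₀ : ℝ} {P : Fin N → ℝ}

lemma hHat_pos (hA : 0 < A) (hB : 0 < B) (hβ : 0 < β) (hαβ : β < α) : 0 < hHat A B α β := by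
  have := hβ.trans hαβ
  unfold hHat
  positivity

lemma axialForce_hHat_mul (hA : 0 < A) (hB : 0 < B) (hβ : 0 < β) (hαβ : β < α) (hr : 0 < r) :
    axialForce A B α β (hHat A B α β * r) =
      β * B * hHat A B α β ^ (-(β + 1)) * pairForce α β r := by
  have hα := hβ.trans hαβ
  have hH := hHat_pos hA hB hβ hαβ
  have hbalance : hHat A B α β ^ (α - β) = α * A / (β * B) := by
    rw [hHat, ← Real.rpow_mul (by positivity), one_div_mul_cancel (by linarith), Real.rpow_one]
  have hpow : hHat A B α β ^ (-(β + 1)) = hHat A B α β ^ (-(α + 1)) * (α * A / (β * B)) := by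
    rw [← hbalance, ← Real.rpow_add hH]
    ring_nf
  rw [axialForce, pairForce, Real.mul_rpow hH.le hr.le, Real.mul_rpow hH.le hr.le, hpow]
  field_simp

lemma hCheck_eq_hHat_mul (hA : 0 < A) (hB : 0 < B) (hβ : 1 < β) (hαβ : β < α) :
    hCheck A B α β = hHat A B α β * minBond α β := by
  have hα : 0 < α := by linarith
  have := zeta_pos hβ
  rw [hCheck, hHat, minBond, ← Real.mul_rpow (by positivity) (by positivity), div_mul_div_comm,
    mul_one]

lemma hBar_eq_hHat_mul (hA : 0 < A) (hB : 0 < B) (hβ : 1 < β) (hαβ : β < α) :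
    hBar A B α β = hHat A B α β * limitBond α β := by
  have hα : 0 < α := by linarith
  have := zeta_pos hβ
  have := zeta_pos (hβ.trans hαβ)
  rw [hBar, hHat, limitBond, ← Real.mul_rpow (by positivity) (by positivity), div_mul_div_comm]

/-- The positions of a spear in units of `hHat A B α β`, extended by `0` beyond `N - 1`. -/
noncomputable def normalizedPos (A B α β : ℝ) (P : Fin N → ℝ) (i : ℕ) : ℝ :=
  Function.extend Fin.val P 0 i / hHat A B α β

lemma hHat_mul_normalizedPos (hA : 0 < A) (hB : 0 < B) (hβ : 0 < β) (hαβ : β < α) (i : Fin N) :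
    hHat A B α β * normalizedPos A B α β P i = P i := by
  rw [normalizedPos, Fin.val_injective.extend_apply, mul_div_cancel₀ _ (hHat_pos hA hB hβ hαβ).ne']

lemma hHat_mul_normalizedPos_sub (hA : 0 < A) (hB : 0 < B) (hβ : 0 < β) (hαβ : β < α)
    (k l : Fin N) :
    hHat A B α β * (normalizedPos A B α β P k - normalizedPos A B α β P l) = P k - P l := by
  rw [mul_sub, hHat_mul_normalizedPos hA hB hβ hαβ, hHat_mul_normalizedPos hA hB hβ hαβ]

lemma gap_eq_hHat_mul (hA : 0 < A) (hB : 0 < B) (hβ : 0 < β) (hαβ : β < α) (hP : Monotone P)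
    {p : ℕ} (hp : p + 1 < N) :
    gap P (p + 1) hp =
      hHat A B α β * (normalizedPos A B α β P (p + 1) - normalizedPos A B α β P p) := by
  rw [hHat_mul_normalizedPos_sub hA hB hβ hαβ ⟨p + 1, hp⟩ ⟨p, by omega⟩]
  simp only [gap, spear, single_sub_single, Nat.add_sub_cancel]
  rw [PiLp.norm_single, norm_sub_rev, Real.norm_of_nonneg (sub_nonneg.2 (hP (by simp)))]

-- Moving all particles beyond `p` together only changes the distances across the bond at `p`.
lemma sum_Iio_mul_indicator_sub (p : ℕ) (F : ℕ → ℕ → ℝ) :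
    ∑ k : Fin N, ∑ l ∈ Finset.Iio k,
      F l k * ((if p < k then 1 else 0) - (if p < l then 1 else 0)) =
      ∑ q ∈ pairsAcross p N, F q.1 q.2 := by
  have hindicator : ∀ k : Fin N, ∀ l ∈ Finset.Iio k,
      F l k * ((if p < k then 1 else 0) - (if p < l then 1 else 0)) =
        if (l : ℕ) ≤ p ∧ p < k then F l k else 0 := fun k l hl => by
    rw [Finset.mem_Iio, Fin.lt_def] at hl
    split_ifs <;> first | omega | simp
  rw [Finset.sum_congr rfl fun k _ => Finset.sum_congr rfl (hindicator k), Finset.sum_sigma',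
    ← Finset.sum_filter]
  refine Finset.sum_nbij (fun x => ((x.2 : ℕ), (x.1 : ℕ))) ?_ ?_ ?_ fun _ _ => rfl
  · rintro ⟨k, l⟩ hx
    simp only [Finset.mem_filter] at hx
    exact mem_pairsAcross.2 ⟨hx.2.1, hx.2.2, k.2⟩
  · rintro ⟨k, l⟩ _ ⟨k', l'⟩ _ h
    simpa [Fin.ext_iff, and_comm] using h
  · rintro ⟨i, j⟩ hq
    rw [Finset.mem_coe, mem_pairsAcross] at hq
    refine ⟨⟨⟨j, hq.2.2⟩, ⟨i, by omega⟩⟩, ?_, rfl⟩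
    simpa [hq.1, hq.2.1] using hq.1.trans_lt hq.2.1

theorem IsCriticalSpear.balanced (hA : 0 < A) (hB : 0 < B) (hβ : 0 < β) (hαβ : β < α)
    (h : IsCriticalSpear A B B₀ α β P) : Balanced α β N (normalizedPos A B α β P) := by
  have hH := hHat_pos hA hB hβ hαβ
  have hP := h.strictMono
  set y := normalizedPos A B α β P
  have hlt : ∀ l k : Fin N, l < k → 0 < y k - y l := fun l k hlk => by
    refine pos_of_mul_pos_right (a := hHat A B α β) ?_ hH.le
    rw [hHat_mul_normalizedPos_sub hA hB hβ hαβ]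
    exact sub_pos.2 (hP hlk)
  refine ⟨fun p hp => sub_pos.1 (hlt ⟨p, by omega⟩ ⟨p + 1, hp⟩ (by simp)), fun p _ => ?_⟩
  set K := β * B * hHat A B α β ^ (-(β + 1))
  have hK : K ≠ 0 := by positivity
  have hforce : ∀ k : Fin N, ∀ l ∈ Finset.Iio k,
      axialForce A B α β (P k - P l) = K * pairForce α β (y k - y l) := fun k l hl => by
    rw [← hHat_mul_normalizedPos_sub hA hB hβ hαβ,
      axialForce_hHat_mul hA hB hβ hαβ (hlt l k (Finset.mem_Iio.1 hl))]
  have hcrit := (isCriticalPoint_spear_iff hP).1 h.2 fun k => if p < k then 1 else 0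
  rw [Finset.sum_congr rfl fun k _ => Finset.sum_congr rfl fun l hl => by rw [hforce k l hl],
    sum_Iio_mul_indicator_sub p fun l k => K * pairForce α β (y k - y l), ← Finset.mul_sum] at hcrit
  exact (mul_eq_zero_iff_left hK).1 hcrit

end Normalization

/-! ### Chains of minimal energy -/

section ChainEnergy

variable {V : ℝ → ℝ} {H : ℝ} {g h : ℕ → ℝ}

/-- The energy of a chain of `N` particles with bond lengths `h 0, …, h (N - 2)` under the pair
potential `V`. -/
noncomputable def chainEnergy (V : ℝ → ℝ) (N : ℕ) (h : ℕ → ℝ) : ℝ :=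
  ∑ k : Fin N, ∑ l ∈ Finset.Iio k, V (∑ i ∈ Finset.Ico (l : ℕ) k, h i)

lemma chainEnergy_congr (hgh : ∀ i, i + 1 < N → g i = h i) :
    chainEnergy V N g = chainEnergy V N h := by
  refine Finset.sum_congr rfl fun k _ => Finset.sum_congr rfl fun l _ => ?_
  refine congrArg V (Finset.sum_congr rfl fun i hi => hgh i ?_)
  have := (Finset.mem_Ico.1 hi).2
  omega

lemma sum_Ico_pos (hh : ∀ i, 0 < h i) {l k : ℕ} (hlk : l < k) : 0 < ∑ i ∈ Finset.Ico l k, h i :=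
  Finset.sum_pos (fun i _ => hh i) (Finset.nonempty_Ico.2 hlk)

lemma chainEnergy_min_le (hH : 0 < H) (hmono : MonotoneOn V (Set.Ici H)) (hh : ∀ i, 0 < h i) :
    chainEnergy V N (fun i => min (h i) H) ≤ chainEnergy V N h := by
  refine Finset.sum_le_sum fun k _ => Finset.sum_le_sum fun l _ => ?_
  by_cases hshort : ∀ i ∈ Finset.Ico (l : ℕ) k, h i ≤ H
  · rw [Finset.sum_congr rfl fun i hi => min_eq_left (hshort i hi)]
  · push Not at hshort
    obtain ⟨i, hi, hlong⟩ := hshort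
    have hle : ∑ i ∈ Finset.Ico (l : ℕ) k, min (h i) H ≤ ∑ i ∈ Finset.Ico (l : ℕ) k, h i :=
      Finset.sum_le_sum fun j _ => min_le_left _ _
    have hHle : H ≤ ∑ i ∈ Finset.Ico (l : ℕ) k, min (h i) H :=
      calc H = min (h i) H := (min_eq_right hlong.le).symm
        _ ≤ _ := Finset.single_le_sum (f := fun i => min (h i) H)
          (fun j _ => (lt_min (hh j) hH).le) hi
    exact hmono hHle (hHle.trans hle) hle

lemma continuousOn_chainEnergy (hV : ContinuousOn V (Set.Ioi 0)) (N : ℕ) :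
    ContinuousOn (chainEnergy V N) {h | ∀ i, 0 < h i} :=
  continuousOn_finsetSum _ fun _ _ => continuousOn_finsetSum _ fun _ hl =>
    hV.comp (continuous_finsetSum _ fun i _ => continuous_apply i).continuousOn
      fun _ hh => sum_Ico_pos hh (Fin.lt_def.1 (Finset.mem_Iio.1 hl))

lemma le_chainEnergy (hmin : ∀ r, 0 < r → V H ≤ V r) (hh : ∀ i, 0 < h i) {i : ℕ}
    (hi : i + 1 < N) :
    V (h i) - V H + ∑ k : Fin N, ∑ _l ∈ Finset.Iio k, V H ≤ chainEnergy V N h := by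
  rw [← le_sub_iff_add_le, chainEnergy, ← Finset.sum_sub_distrib]
  simp only [← Finset.sum_sub_distrib]
  have hnonneg : ∀ k : Fin N, ∀ l ∈ Finset.Iio k,
      0 ≤ V (∑ i ∈ Finset.Ico (l : ℕ) k, h i) - V H := fun k l hl =>
    sub_nonneg.2 (hmin _ (sum_Ico_pos hh (Fin.lt_def.1 (Finset.mem_Iio.1 hl))))
  calc V (h i) - V H = V (∑ j ∈ Finset.Ico i (i + 1), h j) - V H := by simp
    _ ≤ ∑ l ∈ Finset.Iio (⟨i + 1, hi⟩ : Fin N), (V (∑ j ∈ Finset.Ico (l : ℕ) (i + 1), h j) - V H) :=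
        Finset.single_le_sum (hnonneg ⟨i + 1, hi⟩)
          (show (⟨i, by omega⟩ : Fin N) ∈ Finset.Iio ⟨i + 1, hi⟩ by simp)
    _ ≤ _ := Finset.single_le_sum
        (f := fun k : Fin N => ∑ l ∈ Finset.Iio k, (V (∑ j ∈ Finset.Ico (l : ℕ) k, h j) - V H))
        (fun k _ => Finset.sum_nonneg (hnonneg k)) (Finset.mem_univ _)

lemma exists_forall_lt_chainEnergy (hmin : ∀ r, 0 < r → V H ≤ V r)
    (hlim : Filter.Tendsto V (nhdsWithin 0 (Set.Ioi 0)) Filter.atTop) (N : ℕ) (T : ℝ) :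
    ∃ ε > 0, ∀ h : ℕ → ℝ, (∀ i, 0 < h i) → ∀ i, i + 1 < N → h i < ε → T < chainEnergy V N h := by
  obtain ⟨ε, hε, hlarge⟩ := mem_nhdsGT_iff_exists_Ioo_subset.1 (hlim.eventually_gt_atTop
    (T + V H - ∑ k : Fin N, ∑ _l ∈ Finset.Iio k, V H))
  refine ⟨ε, hε, fun h hh i hi hlt => ?_⟩
  have hT : T + V H - ∑ k : Fin N, ∑ _l ∈ Finset.Iio k, V H < V (h i) := hlarge ⟨hh i, hlt⟩
  linarith [le_chainEnergy hmin hh hi]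

theorem exists_chainEnergy_le (hH : 0 < H) (hV : ContinuousOn V (Set.Ioi 0))
    (hmin : ∀ r, 0 < r → V H ≤ V r) (hmono : MonotoneOn V (Set.Ici H))
    (hlim : Filter.Tendsto V (nhdsWithin 0 (Set.Ioi 0)) Filter.atTop) (N : ℕ) :
    ∃ h : ℕ → ℝ, (∀ i, 0 < h i) ∧
      ∀ g : ℕ → ℝ, (∀ i, 0 < g i) → chainEnergy V N h ≤ chainEnergy V N g := by
  obtain ⟨ε, hε, hlarge⟩ := exists_forall_lt_chainEnergy hmin hlim N (chainEnergy V N fun _ => H)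
  have hεH : 0 < min ε H := lt_min hε hH
  set K := Set.pi Set.univ fun _ : ℕ => Set.Icc (min ε H) H
  have hK : ∀ h ∈ K, ∀ i, 0 < h i := fun h hh i => hεH.trans_le (hh i trivial).1
  have hHK : (fun _ => H) ∈ K := fun i _ => ⟨min_le_right _ _, le_rfl⟩
  obtain ⟨h, hhK, hh⟩ := (isCompact_univ_pi fun _ : ℕ => isCompact_Icc).exists_isMinOn ⟨_, hHK⟩
    ((continuousOn_chainEnergy hV N).mono hK)
  refine ⟨h, hK h hhK, fun g hg => le_trans ?_ (chainEnergy_min_le hH hmono hg)⟩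
  by_cases hshort : ∃ i, i + 1 < N ∧ min (g i) H < min ε H
  · obtain ⟨i, hi, hlt⟩ := hshort
    exact (hh hHK).trans (hlarge _ (fun i => lt_min (hg i) hH) i hi
      (hlt.trans_le (min_le_left _ _))).le
  · push Not at hshort
    rw [← chainEnergy_congr fun i hi => max_eq_right (hshort i hi)]
    exact hh fun i _ => ⟨le_max_left _ _, max_le (min_le_right _ _) (min_le_right _ _)⟩

end ChainEnergy

/-! ### Minimization among spears -/

/-- The energy of two aligned particles at distance `r`. -/
noncomputable def pairEnergy (A B α β r : ℝ) : ℝ :=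
  A * r ^ (-α) - B * r ^ (-β)

section PairEnergy

variable {A B : ℝ}

lemma hasDerivAt_pairEnergy (hr : 0 < r) :
    HasDerivAt (pairEnergy A B α β) (axialForce A B α β r) r := by
  refine (((Real.hasDerivAt_rpow_const (p := -α) (Or.inl hr.ne')).const_mul A).sub
    ((Real.hasDerivAt_rpow_const (p := -β) (Or.inl hr.ne')).const_mul B)).congr_deriv ?_
  rw [axialForce, neg_add', neg_add']
  ring

lemma continuousOn_pairEnergy : ContinuousOn (pairEnergy A B α β) (Set.Ioi 0) := fun _ hr =>
  (hasDerivAt_pairEnergy hr).continuousAt.continuousWithinAt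

lemma deriv_pairEnergy_eq (hA : 0 < A) (hB : 0 < B) (hβ : 0 < β) (hαβ : β < α) (hr : 0 < r) :
    deriv (pairEnergy A B α β) r =
      β * B * hHat A B α β ^ (-(β + 1)) * pairForce α β (r / hHat A B α β) := by
  have hH := hHat_pos hA hB hβ hαβ
  rw [(hasDerivAt_pairEnergy hr).deriv, ← axialForce_hHat_mul hA hB hβ hαβ (div_pos hr hH),
    mul_div_cancel₀ _ hH.ne']

lemma monotoneOn_pairEnergy (hA : 0 < A) (hB : 0 < B) (hβ : 0 < β) (hαβ : β < α) :
    MonotoneOn (pairEnergy A B α β) (Set.Ici (hHat A B α β)) := by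
  have hH := hHat_pos hA hB hβ hαβ
  refine monotoneOn_of_deriv_nonneg (convex_Ici _)
    (continuousOn_pairEnergy.mono fun r hr => hH.trans_le hr)
    (fun r hr => (hasDerivAt_pairEnergy
      (hH.trans_le (interior_subset hr))).differentiableAt.differentiableWithinAt)
    fun r hr => ?_
  have hr : hHat A B α β ≤ r := interior_subset hr
  rw [deriv_pairEnergy_eq hA hB hβ hαβ (hH.trans_le hr)]
  exact mul_nonneg (by positivity) (pairForce_nonneg hαβ.le ((one_le_div hH).2 hr))

lemma antitoneOn_pairEnergy (hA : 0 < A) (hB : 0 < B) (hβ : 0 < β) (hαβ : β < α) :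
    AntitoneOn (pairEnergy A B α β) (Set.Ioc 0 (hHat A B α β)) := by
  have hH := hHat_pos hA hB hβ hαβ
  refine antitoneOn_of_deriv_nonpos (convex_Ioc _ _)
    (continuousOn_pairEnergy.mono fun r hr => hr.1)
    (fun r hr => (hasDerivAt_pairEnergy
      (interior_subset hr).1).differentiableAt.differentiableWithinAt)
    fun r hr => ?_
  have hr := interior_subset hr
  rw [deriv_pairEnergy_eq hA hB hβ hαβ hr.1]
  exact mul_nonpos_of_nonneg_of_nonpos (by positivity)
    (pairForce_nonpos hαβ.le (div_pos hr.1 hH) ((div_le_one hH).2 hr.2))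

lemma pairEnergy_hHat_le (hA : 0 < A) (hB : 0 < B) (hβ : 0 < β) (hαβ : β < α) (hr : 0 < r) :
    pairEnergy A B α β (hHat A B α β) ≤ pairEnergy A B α β r := by
  have hH := hHat_pos hA hB hβ hαβ
  rcases le_total r (hHat A B α β) with hle | hle
  · exact antitoneOn_pairEnergy hA hB hβ hαβ ⟨hr, hle⟩ ⟨hH, le_rfl⟩ hle
  · exact monotoneOn_pairEnergy hA hB hβ hαβ Set.self_mem_Ici hle hle

lemma tendsto_pairEnergy (hA : 0 < A) (hβ : 0 < β) (hαβ : β < α) :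
    Filter.Tendsto (pairEnergy A B α β) (nhdsWithin 0 (Set.Ioi 0)) Filter.atTop := by
  have hprod : Filter.Tendsto (fun r : ℝ => r ^ (-β) * (A * r ^ (-(α - β)) + -B))
      (nhdsWithin 0 (Set.Ioi 0)) Filter.atTop :=
    (tendsto_rpow_neg_nhdsGT_zero (by linarith)).atTop_mul_atTop₀
      (Filter.tendsto_atTop_add_const_right _ _
        ((tendsto_rpow_neg_nhdsGT_zero (by linarith)).const_mul_atTop hA))
  refine hprod.congr' ?_
  filter_upwards [self_mem_nhdsWithin] with r (hr : 0 < r)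
  have hpow : r ^ (-α) = r ^ (-β) * r ^ (-(α - β)) := by
    rw [← Real.rpow_add hr]
    ring_nf
  rw [pairEnergy, hpow]
  ring

end PairEnergy

lemma two_mul_sum_Iio {G : Fin N → Fin N → ℝ} (hG : ∀ k l, G k l = G l k) :
    2 * ∑ k, ∑ l ∈ Finset.Iio k, G k l = ∑ k, ∑ l ∈ {k}ᶜ, G k l := by
  have hswap : ∑ k, ∑ l ∈ Finset.Iio k, G k l = ∑ k, ∑ l ∈ Finset.Ioi k, G k l := by
    rw [Finset.sum_comm' (t' := Finset.univ) (s' := Finset.Ioi) (by simp)]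
    simp only [hG]
  rw [hswap, Finset.mul_sum]
  simp only [Finset.mul_sum, two_mul]
  simpa only [hG] using Finset.sum_sum_Ioi_add_eq_sum_sum_off_diag G

lemma sum_Iio_comp_perm {G : Fin N → Fin N → ℝ} (hG : ∀ k l, G k l = G l k)
    (σ : Equiv.Perm (Fin N)) :
    ∑ k, ∑ l ∈ Finset.Iio k, G (σ k) (σ l) = ∑ k, ∑ l ∈ Finset.Iio k, G k l := by
  refine mul_left_cancel₀ (two_ne_zero (α := ℝ)) ?_
  rw [two_mul_sum_Iio hG, two_mul_sum_Iio fun k l => hG (σ k) (σ l)]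
  exact Fintype.sum_equiv σ _ _ fun k => Finset.sum_equiv σ (by simp) (by simp)

section Spear

variable {A B B₀ : ℝ} {P : Fin N → ℝ}

lemma energy_spear (A B B₀ α β : ℝ) (hP : Function.Injective P) :
    energy A B B₀ α β (spear P) =
      ∑ k, ∑ l ∈ Finset.Iio k, pairEnergy A B α β |P k - P l| := by
  simp only [energy, ← Finset.sum_add_distrib]
  refine Finset.sum_congr rfl fun k _ => Finset.sum_congr rfl fun l hl => ?_
  have hpos : 0 < |P k - P l| := abs_pos.2 (sub_ne_zero.2 (hP.ne (Finset.mem_Iio.1 hl).ne'))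
  have hself : inner ℝ (axisSpin : E3) axisSpin = 1 := by rw [inner_axisSpin]; simp [axisSpin]
  have haxial : inner ℝ (axisSpin : E3) (EuclideanSpace.single 0 (P k - P l)) = P k - P l := by
    rw [inner_axisSpin]; simp
  have hpow : |P k - P l| ^ (β + 2) = |P k - P l| ^ β * ((P k - P l) * (P k - P l)) := by
    rw [Real.rpow_add hpos, Real.rpow_two, sq_abs, sq]
  have hne : P k - P l ≠ 0 := abs_pos.1 hpos
  simp only [dipolarPair, repulsivePair, spear, single_sub_single, hself, haxial,
    PiLp.norm_single, Real.norm_eq_abs, hpow, pairEnergy, Real.rpow_neg hpos.le]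
  field_simp
  ring

lemma energy_spear_comp_perm (A B B₀ α β : ℝ) (hP : Function.Injective P)
    (σ : Equiv.Perm (Fin N)) :
    energy A B B₀ α β (spear (P ∘ σ)) = energy A B B₀ α β (spear P) := by
  rw [energy_spear _ _ _ _ _ hP, energy_spear _ _ _ _ _ (hP.comp σ.injective)]
  exact sum_Iio_comp_perm (G := fun k l => pairEnergy A B α β |P k - P l|)
    (fun k l => by rw [abs_sub_comm]) σ

lemma energy_spear_eq_chainEnergy (A B B₀ α β : ℝ) (hP : StrictMono P) {h : ℕ → ℝ}
    (hh : ∀ l k, l < k → P k - P l = ∑ i ∈ Finset.Ico (l : ℕ) k, h i) :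
    energy A B B₀ α β (spear P) = chainEnergy (pairEnergy A B α β) N h := by
  rw [energy_spear _ _ _ _ _ hP.injective]
  refine Finset.sum_congr rfl fun k _ => Finset.sum_congr rfl fun l hl => ?_
  have hlk := Finset.mem_Iio.1 hl
  rw [abs_of_pos (sub_pos.2 (hP hlk)), hh l k hlk]

lemma exists_bonds_of_strictMono (hP : StrictMono P) : ∃ h : ℕ → ℝ, (∀ i, 0 < h i) ∧
    ∀ l k : Fin N, l < k → P k - P l = ∑ i ∈ Finset.Ico (l : ℕ) k, h i := by
  set y := Function.extend Fin.val P 0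
  have hy : ∀ i : Fin N, y i = P i := Fin.val_injective.extend_apply P 0
  refine ⟨fun i => if i + 1 < N then y (i + 1) - y i else 1, fun i => ?_, fun l k hlk => ?_⟩
  · dsimp only
    split_ifs with hi
    · rw [hy ⟨i + 1, hi⟩, hy ⟨i, by omega⟩]
      exact sub_pos.2 (hP (by simp))
    · exact one_pos
  · rw [← hy, ← hy, ← Finset.sum_Ico_sub y hlk.le]
    refine Finset.sum_congr rfl fun i hi => (if_pos ?_).symm
    have := (Finset.mem_Ico.1 hi).2
    omega

lemma exists_strictMono_of_bonds {h : ℕ → ℝ} (hh : ∀ i, 0 < h i) (N : ℕ) :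
    ∃ P : Fin N → ℝ, StrictMono P ∧
      ∀ l k : Fin N, l < k → P k - P l = ∑ i ∈ Finset.Ico (l : ℕ) k, h i := by
  have hsub : ∀ l k : Fin N, l < k →
      ∑ i ∈ Finset.range k, h i - ∑ i ∈ Finset.range l, h i = ∑ i ∈ Finset.Ico (l : ℕ) k, h i :=
    fun l k hlk => (Finset.sum_Ico_eq_sub h hlk.le).symm
  exact ⟨fun k => ∑ i ∈ Finset.range k, h i,
    fun l k hlk => sub_pos.1 (hsub l k hlk ▸ sum_Ico_pos hh hlk), hsub⟩

theorem exists_strictMono_isMinimizingSpear (hA : 0 < A) (hB : 0 < B) (hβ : 0 < β) (hαβ : β < α)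
    (B₀ : ℝ) (N : ℕ) :
    ∃ P : Fin N → ℝ, StrictMono P ∧ IsMinimizingSpear A B B₀ α β P := by
  obtain ⟨h, hh, hmin⟩ := exists_chainEnergy_le (hHat_pos hA hB hβ hαβ) continuousOn_pairEnergy
    (fun _ => pairEnergy_hHat_le hA hB hβ hαβ) (monotoneOn_pairEnergy hA hB hβ hαβ)
    (tendsto_pairEnergy hA hβ hαβ) N
  obtain ⟨P, hP, hPh⟩ := exists_strictMono_of_bonds hh N
  refine ⟨P, hP, collisionFree_spear_iff.2 hP.injective, fun Q hQ => ?_⟩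
  rw [collisionFree_spear_iff] at hQ
  have hsort : StrictMono (Q ∘ Tuple.sort Q) :=
    (Tuple.monotone_sort Q).strictMono_of_injective (hQ.comp (Tuple.sort Q).injective)
  obtain ⟨g, hg, hQg⟩ := exists_bonds_of_strictMono hsort
  calc energy A B B₀ α β (spear P) = chainEnergy (pairEnergy A B α β) N h :=
        energy_spear_eq_chainEnergy A B B₀ α β hP hPh
    _ ≤ chainEnergy (pairEnergy A B α β) N g := hmin g hg
    _ = energy A B B₀ α β (spear (Q ∘ Tuple.sort Q)) :=
        (energy_spear_eq_chainEnergy A B B₀ α β hsort hQg).symm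
    _ = energy A B B₀ α β (spear Q) := energy_spear_comp_perm A B B₀ α β hQ _

lemma eventually_strictMono_add_mul (hP : StrictMono P) (v : Fin N → ℝ) :
    ∀ᶠ t in nhds (0 : ℝ), StrictMono fun k => P k + t * v k := by
  refine Filter.eventually_all.2 fun k => Filter.eventually_all.2 fun l => ?_
  by_cases hkl : k < l
  · have hcont : ∀ i : Fin N, ContinuousAt (fun t : ℝ => P i + t * v i) 0 := fun i => by fun_prop
    filter_upwards [(hcont k).eventually_lt (hcont l) (by simpa using hP hkl)] with t ht _ using ht
  · exact Filter.Eventually.of_forall fun t hkl' => absurd hkl' hkl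

lemma IsMinimizingSpear.isCriticalSpear (hmin : IsMinimizingSpear A B B₀ α β P)
    (hP : StrictMono P) : IsCriticalSpear A B B₀ α β P := by
  refine ⟨hP.monotone, (isCriticalPoint_spear_iff hP).2 fun v => ?_⟩
  refine IsLocalMin.hasDerivAt_eq_zero ?_ (hasDerivAt_energy_spear A B B₀ α β hP v)
  filter_upwards [eventually_strictMono_add_mul hP v] with t ht
  simpa using hmin.2 _ (collisionFree_spear_iff.2 ht.injective)

end Spear

/-! ### Distances in critical spears -/

section CriticalSpears

variable {A B B₀ : ℝ} {P Q : Fin N → ℝ} {k : ℕ}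

lemma IsCriticalSpear.gap_le_hHat (hA : 0 < A) (hB : 0 < B) (hβ : 0 < β) (hαβ : β < α)
    (h : IsCriticalSpear A B B₀ α β P) (hk : k < N) (hk1 : 1 ≤ k) :
    gap P k hk ≤ hHat A B α β := by
  obtain ⟨p, rfl⟩ := Nat.exists_eq_add_of_le' hk1
  rw [gap_eq_hHat_mul hA hB hβ hαβ h.1 hk]
  exact mul_le_of_le_one_right (hHat_pos hA hB hβ hαβ).le
    ((h.balanced hA hB hβ hαβ).bond_le_one hαβ hk)

lemma IsCriticalSpear.hCheck_le_gap (hA : 0 < A) (hB : 0 < B) (hβ : 1 < β) (hαβ : β < α)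
    (h : IsCriticalSpear A B B₀ α β P) (hk : k < N) (hk1 : 1 ≤ k) :
    hCheck A B α β ≤ gap P k hk := by
  have hβ0 : 0 < β := one_pos.trans hβ
  obtain ⟨p, rfl⟩ := Nat.exists_eq_add_of_le' hk1
  rw [gap_eq_hHat_mul hA hB hβ0 hαβ h.1 hk, hCheck_eq_hHat_mul hA hB hβ hαβ]
  exact mul_le_mul_of_nonneg_left ((h.balanced hA hB hβ0 hαβ).minBond_le_bond hβ hαβ hk)
    (hHat_pos hA hB hβ0 hαβ).le

theorem IsCriticalSpear.exists_eq_add (hA : 0 < A) (hB : 0 < B) (h : StiffExponent α β)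
    (hP : IsCriticalSpear A B B₀ α β P) (hQ : IsCriticalSpear A B B₀ α β Q) :
    ∃ t : ℝ, ∀ i, Q i = P i + t := by
  have hβ : 0 < β := one_pos.trans h.one_lt
  have hyP := hP.balanced hA hB hβ h.lt
  have hyQ := hQ.balanced hA hB hβ h.lt
  set y := normalizedPos A B α β P
  set z := normalizedPos A B α β Q
  have htranslate : ∀ i, i < N → z i - y i = z 0 - y 0 := by
    intro i hi
    induction i with
    | zero => rfl
    | succ i ih => linarith [ih (by omega), hyP.bond_eq h hyQ hi]
  refine ⟨hHat A B α β * (z 0 - y 0), fun i => ?_⟩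
  rw [← htranslate i i.2, mul_sub, hHat_mul_normalizedPos hA hB hβ h.lt,
    hHat_mul_normalizedPos hA hB hβ h.lt]
  ring

theorem exists_gap_bounds (hA : 0 < A) (hB : 0 < B) (B₀ : ℝ) (h : StiffExponent α β) :
    ∃ c C : ℝ, 0 < c ∧ 0 < C ∧
      ∀ (N : ℕ) (P : Fin N → ℝ), IsCriticalSpear A B B₀ α β P →
        ∀ (k : ℕ) (hk : k < N), 1 ≤ k →
          hBar A B α β + c / (N : ℝ) ^ (β - 1) ≤ gap P k hk ∧
          gap P k hk ≤ hBar A B α β +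
            C * (1 / (N : ℝ) ^ (β - 1) + 1 / (k : ℝ) ^ (β - 1) +
              1 / ((N : ℝ) - (k : ℝ)) ^ (β - 1)) := by
  have hβ := h.one_lt
  have hβ0 : 0 < β := one_pos.trans hβ
  have hH := hHat_pos hA hB hβ0 h.lt
  obtain ⟨c, hc, hlower⟩ := exists_limitBond_add_le h
  set D := zeta β * (β / (β - 1))
  have hD : 0 < D := mul_pos (zeta_pos hβ) (div_pos hβ0 (sub_pos.2 hβ))
  refine ⟨hHat A B α β * c, hHat A B α β * D, by positivity, by positivity,
    fun N P hP k hk hk1 => ?_⟩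
  obtain ⟨p, rfl⟩ := Nat.exists_eq_add_of_le' hk1
  have hy := hP.balanced hA hB hβ0 h.lt
  have hpow : ∀ x : ℝ, 0 ≤ x → x ^ (1 - β) = 1 / x ^ (β - 1) := fun x hx => by
    rw [← neg_sub, Real.rpow_neg hx, one_div]
  rw [gap_eq_hHat_mul hA hB hβ0 h.lt hP.1 hk, hBar_eq_hHat_mul hA hB hβ h.lt]
  constructor
  · calc hHat A B α β * limitBond α β + hHat A B α β * c / (N : ℝ) ^ (β - 1)
        = hHat A B α β * (limitBond α β + c * (N : ℝ) ^ (1 - β)) := by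
          rw [hpow _ N.cast_nonneg]
          ring
      _ ≤ _ := mul_le_mul_of_nonneg_left (hlower N _ hy p hk) hH.le
  · have hright : ((N - 1 - p : ℕ) : ℝ) = (N : ℝ) - ((p + 1 : ℕ) : ℝ) := by
      rw [← Nat.cast_sub hk.le, Nat.sub_sub, add_comm 1 p]
    have hend : endEffect β N p =
        1 / ((p + 1 : ℕ) : ℝ) ^ (β - 1) + 1 / ((N : ℝ) - ((p + 1 : ℕ) : ℝ)) ^ (β - 1) := by
      rw [endEffect, hpow _ (by positivity), hpow _ (by positivity), hright]
    rw [mul_assoc, ← mul_add]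
    refine mul_le_mul_of_nonneg_left ((hy.bond_le_limitBond_add h hk).trans ?_) hH.le
    rw [hend, add_assoc (1 / (N : ℝ) ^ (β - 1))]
    exact add_le_add le_rfl
      (mul_le_mul_of_nonneg_left (le_add_of_nonneg_left (by positivity)) hD.le)

end CriticalSpears

end MagneticChain

theorem theorem1_general :
    (∀ A B B₀ α β : ℝ, 0 < A → 0 < B → 0 < β → β < α → ∀ N : ℕ,
      (∃ P₀ : Fin N → ℝ,
        IsCriticalSpear A B B₀ α β P₀ ∧ IsMinimizingSpear A B B₀ α β P₀) ∧
      (∀ P : Fin N → ℝ, IsCriticalSpear A B B₀ α β P →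
        ∀ (k : ℕ) (hk : k < N), 1 ≤ k →
          (1 < β → hCheck A B α β ≤ gap P k hk) ∧ gap P k hk ≤ hHat A B α β)) ∧
    (∀ β : ℝ, 1 < β → ∃ αstar : ℝ, ∀ A B B₀ α : ℝ, 0 < A → 0 < B → αstar < α →
      (∀ (N : ℕ) (P Q : Fin N → ℝ),
        IsCriticalSpear A B B₀ α β P → IsCriticalSpear A B B₀ α β Q →
          ∃ t : ℝ, ∀ i, Q i = P i + t) ∧
      ∃ c C : ℝ, 0 < c ∧ 0 < C ∧
        ∀ (N : ℕ) (P : Fin N → ℝ), IsCriticalSpear A B B₀ α β P →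
          ∀ (k : ℕ) (hk : k < N), 1 ≤ k →
            hBar A B α β + c / (N : ℝ) ^ (β - 1) ≤ gap P k hk ∧
            gap P k hk ≤ hBar A B α β +
              C * (1 / (N : ℝ) ^ (β - 1) + 1 / (k : ℝ) ^ (β - 1) +
                1 / ((N : ℝ) - (k : ℝ)) ^ (β - 1))) := by
  refine ⟨fun A B B₀ α β hA hB hβ hαβ N => ⟨?_, fun P hP k hk hk1 => ?_⟩, fun β hβ => ?_⟩
  · obtain ⟨P, hP, hmin⟩ := exists_strictMono_isMinimizingSpear hA hB hβ hαβ B₀ N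
    exact ⟨P, hmin.isCriticalSpear hP, hmin⟩
  · exact ⟨fun hβ1 => hP.hCheck_le_gap hA hB hβ1 hαβ hk hk1, hP.gap_le_hHat hA hB hβ hαβ hk hk1⟩
  · obtain ⟨αstar, hstiff⟩ := Filter.eventually_atTop.1 (eventually_stiffExponent hβ)
    exact ⟨αstar, fun A B B₀ α hA hB hα =>
      ⟨fun N P Q hP hQ => hP.exists_eq_add hA hB (hstiff α hα.le) hQ,
        exists_gap_bounds hA hB B₀ (hstiff α hα.le)⟩⟩

theorem theorem1 :
    -- parts (i) and (ii)
    (∀ A B B₀ α β : ℝ, 0 < A → 0 < B → 0 < B₀ → 1 < β → β < α → ∀ N : ℕ,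
      (∃ P₀ : Fin N → ℝ,
        IsCriticalSpear A B B₀ α β P₀ ∧ IsMinimizingSpear A B B₀ α β P₀) ∧
      (∀ P : Fin N → ℝ, IsCriticalSpear A B B₀ α β P →
        ∀ (k : ℕ) (hk : k < N), 1 ≤ k →
          hCheck A B α β ≤ gap P k hk ∧ gap P k hk ≤ hHat A B α β)) ∧
    -- part (iii)
    (∀ β : ℝ, 3 ≤ β → ∃ αstar : ℝ, ∀ A B B₀ α : ℝ, 0 < A → 0 < B → 0 < B₀ →
      β < α → αstar < α →
      (∀ (N : ℕ) (P Q : Fin N → ℝ),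
        IsCriticalSpear A B B₀ α β P → IsCriticalSpear A B B₀ α β Q →
          ∃ t : ℝ, ∀ i, Q i = P i + t) ∧
      ∃ c C : ℝ, 0 < c ∧ 0 < C ∧
        ∀ (N : ℕ) (P : Fin N → ℝ), IsCriticalSpear A B B₀ α β P →
          ∀ (k : ℕ) (hk : k < N), 1 ≤ k →
            hBar A B α β + c / (N : ℝ) ^ (β - 1) ≤ gap P k hk ∧
            gap P k hk ≤ hBar A B α β +
              C * (1 / (N : ℝ) ^ (β - 1) + 1 / (k : ℝ) ^ (β - 1) +
                1 / ((N : ℝ) - (k : ℝ)) ^ (β - 1))) := by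
  exact ⟨fun A B B₀ α β hA hB _ hβ hαβ N =>
      (theorem1_general.1 A B B₀ α β hA hB (one_pos.trans hβ) hαβ N).imp_right
        fun h P hP k hk hk1 => (h P hP k hk hk1).imp_left fun h => h hβ,
    fun β hβ => (theorem1_general.2 β (by linarith)).imp
      fun _ h A B B₀ α hA hB _ _ hα => h A B B₀ α hA hB hα⟩
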